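/- **Theorem G.1.** Let $\mathcal X\in\mathbb R^{s\times\cdots\times s}$ be a tensor of order $N$, let $A_1,\dots,A_N\in\mathbb R^{s\times R}$, and consider the $i$-th subproblem of CP-ALS, $\min_{A\in\mathbb R^{s\times R}}\|L_iA^T-R_i\|_F^2$, where $L_i=A_1\odot\cdots\odot A_{i-1}\odot A_{i+1}\odot\cdots\odot A_N$ (Khatri–Rao product) and $R_i=\mathcal X_{(i)}^T$ is the transposed $i$-th matricization of $\mathcal X$. Let $T$ be a contraction tree of the tensor network of $L_i$, that is, a binary tree whose leaves are the vertices $j\neq i$, each occurring once. Let $S_i\in\mathbb R^{m\times s^{N-1}}$ be the Gaussian tensor network embedding built on $T$: (a) the edge of size $s$ of every leaf $j$ is sketched by an $m\times s$ matrix; (b) at every contraction $(U,V)$ of $T$, with $U$ and $V$ already sketched to one dimension of size $m$ each, the sketch dimension of $V$ is written as a pair of dimensions of sizes $\alpha,\beta$ (with $\alpha\beta=m$, or $\alpha\beta\ge m$ with zero padding when sizes are rounded up); a tensor $v_1$, of row size $m$, is contracted with the sketch dimension of $U$ and the one of size $\alpha$, and a tensor $v_2$, of row size $m$, is contracted with the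 row dimension of $v_1$ and the one of size $\beta$, which leaves one dimension of size $m$. Every tensor has independent entries $\tfrac1{\sqrt m}\mathcal N(0,1)$, and all tensors are independent. The choice $\alpha,\beta\approx\sqrt m$ at every contraction is the cost-optimal one; the statement holds for every choice. Then for every $\delta_0<1$ there is a constant $C>0$, depending only on $\delta_0$, such that for all $N,R,s,i,\mathcal X,A_1,\dots,A_N$, all $\varepsilon\in(0,1]$ and $\delta\in(0,\delta_0]$, all $m\ge C\,NR\log(1/\delta)/\varepsilon^2$ and all $S_i$ as above, the following holds with probability at least $1-\delta$: the sketched problem $\min_A\|S_iL_iA^T-S_iR_i\|_F^2$ has a solution, and each of its solutions $\hat A$ is $(1+\varepsilon)$-accurate, that is, $$\|L_i\hat A^T-R_i\|_F^2\le(1+\varepsilon)\min_A\|L_iA^T-R_i\|_F^2 .$$ In particular a sketch size $m=\Theta(NR\log(1/\delta)/\varepsilon^2)$ suffices. -/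

import Mathlib

open MeasureTheory ProbabilityTheory

namespace CPALS

/-- Squared Frobenius norm of a real matrix. -/
def frobSq {κ τ : Type*} [Fintype κ] [Fintype τ] (M : Matrix κ τ ℝ) : ℝ :=
  ∑ x, ∑ y, M x y ^ 2

/-! ### The least squares subproblem of CP-ALS

The input tensor has order `N` and size `s × ⋯ × s`. The rows of the matrices of the `i`-th
subproblem are indexed by the multi-indices `(x_j)` with `j ≠ i`. -/

/-- The Khatri-Rao product `L_i = A_1 ⊙ ⋯ ⊙ A_{i-1} ⊙ A_{i+1} ⊙ ⋯ ⊙ A_N`: its `r`-th column is the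
Kronecker product of the `r`-th columns of the factor matrices `A_j`, `j ≠ i`. -/
def khatriRao {N s R : ℕ} (A : Fin N → Matrix (Fin s) (Fin R) ℝ) (i : Fin N) :
    Matrix ({j : Fin N // j ≠ i} → Fin s) (Fin R) ℝ :=
  Matrix.of fun x r => ∏ j : {j : Fin N // j ≠ i}, A j (x j) r

/-- The transpose `R_i` of the `i`-th matricization of the tensor `X`. -/
def matricizationT {N s : ℕ} (X : (Fin N → Fin s) → ℝ) (i : Fin N) :
    Matrix ({j : Fin N // j ≠ i} → Fin s) (Fin s) ℝ :=
  Matrix.of fun x t => X fun j => if h : j = i then t else x ⟨j, h⟩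

/-- The least squares objective `‖L Bᵀ - Y‖_F²` as a function of the unknown matrix `B`. -/
def lsqObj {κ : Type*} [Fintype κ] {s R : ℕ} (L : Matrix κ (Fin R) ℝ) (Y : Matrix κ (Fin s) ℝ)
    (B : Matrix (Fin s) (Fin R) ℝ) : ℝ :=
  frobSq (L * B.transpose - Y)

/-- `B` solves `min_B ‖L Bᵀ - Y‖_F²`. -/
def IsLsqSolution {κ : Type*} [Fintype κ] {s R : ℕ} (L : Matrix κ (Fin R) ℝ)
    (Y : Matrix κ (Fin s) ℝ) (B : Matrix (Fin s) (Fin R) ℝ) : Prop :=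
  ∀ B', lsqObj L Y B ≤ lsqObj L Y B'

/-- `B` is a `(1+ε)`-accurate solution of `min_B ‖L Bᵀ - Y‖_F²`: its objective value is at most
`1 + ε` times the minimum. -/
def IsLsqAccurate {κ : Type*} [Fintype κ] {s R : ℕ} (ε : ℝ) (L : Matrix κ (Fin R) ℝ)
    (Y : Matrix κ (Fin s) ℝ) (B : Matrix (Fin s) (Fin R) ℝ) : Prop :=
  ∀ B', lsqObj L Y B ≤ (1 + ε) * lsqObj L Y B'

/-! ### The tensor network embedding -/

/-- The graph of the embedding that the sketching algorithm builds on a contraction tree of a data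
tensor network all of whose vertices `j : ι` carry an edge to be sketched.

* `leaf j`: the data vertex `j`; its edge is sketched by one matrix (with `m` rows), a factor of
  the Kronecker product part of the embedding.
* `node l r α β e`: the contraction of the outputs `U` of `l` and `V` of `r`. Both have been
  sketched to one dimension of size `m`. They are sketched to one dimension of size `m` by a small
  network of two tensors `v₁`, `v₂`. The sketch dimension of `V` is viewed, through `e`, as a pair
  of edges of sizes `α` and `β`. The tensor `v₁` is joined to `U` (size `m`), to `V` (size `α`)
  and to `v₂` (size `m`); the tensor `v₂` is joined to `v₁` (size `m`), to `V` (size `β`) and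
  has the output edge (size `m`).

The algorithm takes `α = √(m c / b)` and `β = m / α`, where `c` and `b` are the sizes of the
dimensions of `V` alone and of the dimensions contracted between `U` and `V`. For a Khatri-Rao
product `b = c = 1`, so `α = β = √m`, up to rounding. All choices of `α` and `β` are
allowed here; `e` is a bijection when `α β = m`, and pads when sizes are rounded up. Interchanging
`l` and `r` gives the mirror image of the small network. -/
inductive SketchNetwork (ι : Type) (m : ℕ) : Type
  | leaf (j : ι) : SketchNetwork ι m
  | node (l r : SketchNetwork ι m) (α β : ℕ) (e : Fin m ↪ Fin α × Fin β) : SketchNetwork ι m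

/-- The law of a `p × κ` array of independent `N(0,1)` variables. -/
noncomputable def gaussianArray (p : ℕ) (κ : Type) [Fintype κ] : Measure (Fin p → κ → ℝ) :=
  Measure.pi fun _ => Measure.pi fun _ => gaussianReal 0 1

namespace SketchNetwork

variable {ι : Type} {m : ℕ}

/-- The data vertices at the leaves, from left to right. -/
def leaves : SketchNetwork ι m → List ι
  | leaf j => [j]
  | node l r _ _ _ => l.leaves ++ r.leaves

/-- The underlying binary tree is a contraction tree of the full set `ι` of data vertices: every
data vertex is at exactly one leaf. -/
def IsContractionTree (T : SketchNetwork ι m) : Prop :=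
  T.leaves.Nodup ∧ ∀ j, j ∈ T.leaves

/-- The values of all tensors of the embedding, before normalization, when the sketched edges have
size `s`. Each tensor is matricized: its first index is the row, that is the output edge or the
edge to the tensor that follows it, and its second index is the column. -/
def Sample (s : ℕ) : SketchNetwork ι m → Type
  | leaf _ => Fin m → Fin s → ℝ
  | node l r α β _ =>
      l.Sample s × r.Sample s × (Fin m → Fin m × Fin α → ℝ) × (Fin m → Fin m × Fin β → ℝ)

instance instMeasurableSpaceSample (s : ℕ) :
    (T : SketchNetwork ι m) → MeasurableSpace (T.Sample s)
  | leaf _ => inferInstanceAs (MeasurableSpace (Fin m → Fin s → ℝ))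
  | node l r α β _ =>
      letI := instMeasurableSpaceSample s l
      letI := instMeasurableSpaceSample s r
      inferInstanceAs (MeasurableSpace (l.Sample s × r.Sample s ×
        (Fin m → Fin m × Fin α → ℝ) × (Fin m → Fin m × Fin β → ℝ)))

/-- All entries of all tensors are independent `N(0,1)` variables. -/
noncomputable def law (s : ℕ) : (T : SketchNetwork ι m) → Measure (T.Sample s)
  | leaf _ => gaussianArray m (Fin s)
  | node l r α β _ => (l.law s).prod ((r.law s).prod
      ((gaussianArray m (Fin m × Fin α)).prod (gaussianArray m (Fin m × Fin β))))

/-- The contraction of the tensor network, as an array with the output index `o` and the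
multi-index `x` of the sketched edges. Every tensor is a Gaussian embedding `(1/√m) G`, where `m`
is the row size of its matricization. -/
noncomputable def contract (s : ℕ) :
    (T : SketchNetwork ι m) → T.Sample s → Fin m → (ι → Fin s) → ℝ
  | leaf j, G, o, x => (1 / √(m : ℝ)) * G o (x j)
  | node l r _ _ e, (Gl, Gr, G₁, G₂), o, x =>
      ∑ a : Fin m, ∑ b : Fin m, ∑ q : Fin m,
        l.contract s Gl a x * r.contract s Gr b x *
          ((1 / √(m : ℝ)) * G₁ q (a, (e b).1)) * ((1 / √(m : ℝ)) * G₂ o (q, (e b).2))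

/-- The embedding matrix `S`. -/
noncomputable def embedding (s : ℕ) (T : SketchNetwork ι m) (G : T.Sample s) :
    Matrix (Fin m) (ι → Fin s) ℝ :=
  Matrix.of fun o x => T.contract s G o x

end SketchNetwork

end CPALS

/-!
The whole argument rests on moments of `‖S x‖²` of both signs. For one Gaussian tensor, tensored
with identities, and for `4 |q| ≤ m`, the `q`-th moment of the squared norm grows by a factor of at
most `exp (4 q² / m)`: after normalization it is a weighted mean of chi-squared variables, one per
column, and `y ↦ y ^ q` is convex for positive and for negative `q`. A contraction tree on `n`
leaves is a product of `3 n - 2` such tensors, so conditioning on the tensors already applied gives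
a factor of at most `exp (12 n q² / m)` for the embedding `S`.

Bernoulli's inequality `|j (y - 1)| ≤ max (y ^ j) (y⁻¹ ^ j)`, raised to the power `2 p`, turns the
moments of orders `± 2 p j` of `‖S u‖²` into the bound `2 (e / j²) ^ p` on the `2 p`-th moment of
`‖S u‖² - 1`, as soon as `m ≥ 48 n p j²`. A net of the unit ball then makes `S` a subspace
embedding with constant distortion (`p ≈ R + log (1 / δ)`, `j` constant), and Minkowski's inequality
bounds the inner products of `S u` and `S b` for `u` in the column space of `L` and `b` orthogonal
to it (`p ≈ log (1 / δ)`, `j² ≈ R / ε`). These two facts make every solution of the sketched problem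
`(1 + ε)`-accurate.
-/

namespace CPALS

open scoped ENNReal InnerProductSpace Kronecker

/-! ### The chi-squared distribution -/

lemma ext_of_lintegral_exp_mul {μ ν : Measure ℝ} [IsFiniteMeasure μ] [IsFiniteMeasure ν] {δ : ℝ}
    (hδ : 0 < δ)
    (hμ : ∀ t, |t| < δ → ∫⁻ x, ENNReal.ofReal (Real.exp (t * x)) ∂μ ≠ ⊤)
    (h : ∀ t, |t| < δ → ∫⁻ x, ENNReal.ofReal (Real.exp (t * x)) ∂μ =
      ∫⁻ x, ENNReal.ofReal (Real.exp (t * x)) ∂ν) : μ = ν := by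
  have hmem : ∀ ρ : Measure ℝ,
      (∀ t, |t| < δ → ∫⁻ x, ENNReal.ofReal (Real.exp (t * x)) ∂ρ ≠ ⊤) →
        Metric.ball 0 δ ⊆ interior (integrableExpSet id ρ) := fun ρ hρ =>
    interior_maximal (fun t ht => (lintegral_ofReal_ne_top_iff_integrable (by fun_prop)
      (.of_forall fun x => (Real.exp_pos _).le)).1 (hρ t (by simpa using ht))) Metric.isOpen_ball
  have hanalytic : ∀ ρ : Measure ℝ,
      (∀ t, |t| < δ → ∫⁻ x, ENNReal.ofReal (Real.exp (t * x)) ∂ρ ≠ ⊤) →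
        AnalyticOnNhd ℂ (complexMGF id ρ) {z | z.re ∈ Metric.ball 0 δ} := fun ρ hρ =>
    analyticOnNhd_complexMGF.mono fun z hz => hmem ρ hρ hz
  have hreal : ∀ t : ℝ, |t| < δ → complexMGF id μ t = complexMGF id ν t := by
    intro t ht
    simp only [complexMGF_ofReal, mgf, id]
    rw [integral_eq_lintegral_of_nonneg_ae (.of_forall fun x => (Real.exp_pos _).le)
      (by fun_prop), integral_eq_lintegral_of_nonneg_ae
      (.of_forall fun x => (Real.exp_pos _).le) (by fun_prop), h t ht]
  have hfreq : ∃ᶠ z in nhdsWithin (0 : ℂ) {0}ᶜ, complexMGF id μ z = complexMGF id ν z := by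
    have htend : Filter.Tendsto ((↑) : ℝ → ℂ) (nhdsWithin 0 {0}ᶜ) (nhdsWithin 0 {0}ᶜ) :=
      tendsto_nhdsWithin_iff.2 ⟨(Complex.continuous_ofReal.tendsto' 0 0 (by simp)).mono_left
        nhdsWithin_le_nhds, eventually_nhdsWithin_of_forall fun t ht => by simpa using ht⟩
    refine htend.frequently (Filter.Eventually.frequently ?_)
    filter_upwards [nhdsWithin_le_nhds (Metric.ball_mem_nhds (0 : ℝ) hδ)] with t ht
    exact hreal t (by simpa using ht)
  have hstrip := (hanalytic μ hμ).eqOn_of_preconnected_of_frequently_eq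
    (hanalytic ν fun t ht => h t ht ▸ hμ t ht)
    ((convex_ball (0 : ℝ) δ).linear_preimage Complex.reLm).isPreconnected
    (z₀ := 0) (by simpa using hδ) hfreq
  refine Measure.ext_of_charFun (funext fun t => ?_)
  rw [← complexMGF_id_mul_I, ← complexMGF_id_mul_I]
  exact hstrip (by simpa using hδ)

lemma lintegral_exp_sq_gaussianReal {t : ℝ} (ht : t < 1 / 2) :
    ∫⁻ x, ENNReal.ofReal (Real.exp (t * x ^ 2)) ∂(gaussianReal 0 1) =
      ENNReal.ofReal (√(1 - 2 * t))⁻¹ := by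
  have hpos : 0 < 1 - 2 * t := by linarith
  rw [gaussianReal_of_var_ne_zero _ one_ne_zero,
    lintegral_withDensity_eq_lintegral_mul _ (measurable_gaussianPDF 0 1) (by fun_prop)]
  have hdensity : ∀ x : ℝ, (gaussianPDF 0 1 * fun x => ENNReal.ofReal (Real.exp (t * x ^ 2))) x =
      ENNReal.ofReal ((√(2 * Real.pi))⁻¹ * Real.exp (-(1 / 2 - t) * x ^ 2)) := by
    intro x
    rw [Pi.mul_apply, gaussianPDF, ← ENNReal.ofReal_mul (gaussianPDFReal_nonneg _ _ _),
      gaussianPDFReal, mul_assoc, ← Real.exp_add]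
    simp only [NNReal.coe_one, mul_one, sub_zero]
    congr 3
    ring
  simp_rw [hdensity]
  rw [← ofReal_integral_eq_lintegral_ofReal
      ((integrable_exp_neg_mul_sq (by linarith)).const_mul _)
      (Filter.Eventually.of_forall fun x => by positivity),
    integral_const_mul, integral_gaussian, ← Real.sqrt_inv, ← Real.sqrt_inv,
    ← Real.sqrt_mul (by positivity)]
  congr 2
  have : 1 / 2 - t ≠ 0 := by linarith
  field_simp

lemma lintegral_prod_pi {ι : Type*} [Fintype ι] {E : Type*} [MeasurableSpace E] (μ : Measure E)
    [IsProbabilityMeasure μ] {f : E → ℝ≥0∞} (hf : Measurable f) :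
    ∫⁻ x, ∏ i : ι, f (x i) ∂(Measure.pi fun _ : ι => μ) = (∫⁻ x, f x ∂μ) ^ Fintype.card ι := by
  rw [lintegral_prod_eq_prod_lintegral_of_indepFun (μ := Measure.pi fun _ : ι => μ)
    Finset.univ (fun i x => f (x i)) (iIndepFun_pi (X := fun _ => f) fun _ => hf.aemeasurable)
    fun i => hf.comp (measurable_pi_apply i), ← Finset.card_univ, ← Finset.prod_const]
  exact Finset.prod_congr rfl fun i _ =>
    (measurePreserving_eval (fun _ : ι => μ) i).lintegral_comp hf

lemma measurable_gammaPDF (a r : ℝ) : Measurable (gammaPDF a r) :=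
  (measurable_gammaPDFReal a r).ennreal_ofReal

lemma lintegral_rpow_mul_exp_gammaMeasure {a r b t : ℝ} (ha : 0 < a) (hab : 0 < a + b)
    (hr : 0 < r) (ht : t < r) :
    ∫⁻ x, ENNReal.ofReal (x ^ b * Real.exp (t * x)) ∂(gammaMeasure a r) =
      ENNReal.ofReal (r ^ a * Real.Gamma (a + b) / (Real.Gamma a * (r - t) ^ (a + b))) := by
  have hrt : 0 < r - t := sub_pos.2 ht
  have := Real.Gamma_pos_of_pos ha
  have := Real.Gamma_pos_of_pos hab
  set K := r ^ a * Real.Gamma (a + b) / (Real.Gamma a * (r - t) ^ (a + b)) with hK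
  have hdensity : (gammaPDF a r * fun x => ENNReal.ofReal (x ^ b * Real.exp (t * x))) =ᵐ[volume]
      fun x => ENNReal.ofReal K * gammaPDF (a + b) (r - t) x := by
    filter_upwards [Measure.ae_ne volume 0] with x hx
    rcases hx.lt_or_gt with hneg | hpos
    · simp [gammaPDF_of_neg hneg]
    · rw [Pi.mul_apply, gammaPDF_of_nonneg hpos.le, gammaPDF_of_nonneg hpos.le,
        ← ENNReal.ofReal_mul (by positivity), ← ENNReal.ofReal_mul (by positivity)]
      congr 1
      rw [hK, show a + b - 1 = a - 1 + b by ring, Real.rpow_add hpos,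
        show -((r - t) * x) = -(r * x) + t * x by ring, Real.exp_add]
      field_simp
  rw [gammaMeasure, lintegral_withDensity_eq_lintegral_mul _ (measurable_gammaPDF a r)
      (by fun_prop),
    lintegral_congr_ae hdensity, lintegral_const_mul _ (measurable_gammaPDF _ _),
    lintegral_gammaPDF_eq_one hab hrt, mul_one]

lemma ae_gammaMeasure_pos (a r : ℝ) : ∀ᵐ x ∂(gammaMeasure a r), 0 < x := by
  rw [gammaMeasure, ae_withDensity_iff (measurable_gammaPDF a r)]
  filter_upwards [Measure.ae_ne volume 0] with x hx hpdf
  exact hx.lt_or_gt.resolve_left fun hneg => hpdf (gammaPDF_of_neg hneg)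

lemma map_sum_sq_pi_gaussianReal {ι : Type*} [Fintype ι] [Nonempty ι] :
    (Measure.pi fun _ : ι => gaussianReal 0 1).map (fun g => ∑ i, g i ^ 2) =
      gammaMeasure (Fintype.card ι / 2) (1 / 2) := by
  have hd : (0 : ℝ) < Fintype.card ι / 2 := by positivity
  have := isProbabilityMeasure_gammaMeasure hd one_half_pos
  have hmap : ∀ t < (1 / 2 : ℝ), ∫⁻ x, ENNReal.ofReal (Real.exp (t * x))
      ∂((Measure.pi fun _ : ι => gaussianReal 0 1).map fun g => ∑ i, g i ^ 2) =
        ENNReal.ofReal (√(1 - 2 * t))⁻¹ ^ Fintype.card ι := by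
    intro t ht
    rw [lintegral_map (by fun_prop) (by fun_prop), ← lintegral_exp_sq_gaussianReal ht,
      ← lintegral_prod_pi _ (by fun_prop)]
    simp_rw [Finset.mul_sum, Real.exp_sum,
      ENNReal.ofReal_prod_of_nonneg fun _ _ => (Real.exp_pos _).le]
  refine ext_of_lintegral_exp_mul one_half_pos (fun t ht => ?_) fun t ht => ?_
  · rw [hmap t (abs_lt.1 ht).2]
    exact ENNReal.pow_ne_top ENNReal.ofReal_ne_top
  · have hgamma := lintegral_rpow_mul_exp_gammaMeasure (b := 0) hd (by simpa using hd) one_half_pos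
      (abs_lt.1 ht).2
    have ht' : 0 < 1 - 2 * t := by linarith [(abs_lt.1 ht).2]
    simp only [Real.rpow_zero, one_mul, add_zero] at hgamma
    rw [hmap t (abs_lt.1 ht).2, hgamma, ← ENNReal.ofReal_pow (by positivity), inv_pow,
      Real.sqrt_eq_rpow, ← Real.rpow_mul_natCast ht'.le,
      mul_comm (Real.Gamma _), mul_div_mul_right _ _ (Real.Gamma_pos_of_pos hd).ne',
      show 1 / 2 - t = 1 / 2 * (1 - 2 * t) by ring, Real.mul_rpow (by norm_num) ht'.le,
      div_mul_cancel_left₀ (by positivity), one_div_mul_eq_div]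

/-! ### Moments of a Gaussian matrix -/

lemma Gamma_mul_pow_le {a : ℝ} (ha : 0 < a) (n : ℕ) :
    Real.Gamma a * a ^ n ≤ Real.Gamma (a + n) := by
  induction n with
  | zero => simp
  | succ n ih =>
    have := Real.Gamma_pos_of_pos ha
    rw [Nat.cast_succ, ← add_assoc, Real.Gamma_add_one (by positivity), pow_succ, ← mul_assoc,
      mul_comm (a + n)]
    gcongr
    linarith [n.cast_nonneg (α := ℝ)]

lemma Gamma_add_nat_le {a : ℝ} (ha : 0 < a) (n : ℕ) :
    Real.Gamma (a + n) ≤ Real.Gamma a * (a + n) ^ n := by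
  induction n with
  | zero => simp
  | succ n ih =>
    have := Real.Gamma_pos_of_pos ha
    calc Real.Gamma (a + (n + 1 : ℕ)) = Real.Gamma (a + n) * (a + n) := by
          rw [Nat.cast_succ, ← add_assoc, Real.Gamma_add_one (by positivity), mul_comm]
      _ ≤ Real.Gamma a * (a + n) ^ n * (a + n) := by gcongr
      _ = Real.Gamma a * (a + n) ^ (n + 1) := by ring
      _ ≤ Real.Gamma a * (a + (n + 1 : ℕ)) ^ (n + 1) := by gcongr; exact n.le_succ

lemma Gamma_add_int_le {a : ℝ} {q : ℤ} (ha : 0 < a) (haq : 0 < a + q) :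
    Real.Gamma (a + q) ≤ Real.Gamma a * (a + q) ^ q := by
  obtain ⟨n, rfl | rfl⟩ := q.eq_nat_or_neg
  · simpa using Gamma_add_nat_le ha n
  · have h := Gamma_mul_pow_le haq n
    rw [zpow_neg, ← div_eq_mul_inv, le_div_iff₀ (by positivity)]
    simpa using h

lemma one_add_zpow_le_exp {y : ℝ} (hy : |y| ≤ 1 / 2) (q : ℤ) (hqy : 0 ≤ q * y) :
    (1 + y) ^ q ≤ Real.exp (2 * q * y) := by
  have := abs_le.1 hy
  have hpos : 0 < 1 + y := by linarith
  rw [← Real.exp_log (zpow_pos hpos q), Real.log_zpow, Real.exp_le_exp]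
  rcases le_or_gt 0 q with hq | hq
  · have h1 : Real.log (1 + y) ≤ y := by linarith [Real.log_le_sub_one_of_pos hpos]
    have hq' : (0 : ℝ) ≤ q := by exact_mod_cast hq
    nlinarith
  · have hq' : (q : ℝ) < 0 := by exact_mod_cast hq
    have hy0 : y ≤ 0 := by nlinarith
    have h1 : 2 * y ≤ Real.log (1 + y) := by
      refine le_trans ?_ (Real.one_sub_inv_le_log_of_pos hpos)
      rw [le_sub_iff_add_le, ← le_sub_iff_add_le', inv_le_iff_one_le_mul₀ hpos]
      nlinarith
    nlinarith

lemma map_sum_mul_pi_gaussianReal {κ : Type*} [Fintype κ] {u : κ → ℝ} (hu : ∑ x, u x ^ 2 = 1) :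
    (Measure.pi fun _ : κ => gaussianReal 0 1).map (fun g => ∑ x, g x * u x) =
      gaussianReal 0 1 := by
  set L : StrongDual ℝ (EuclideanSpace ℝ κ) := innerSL ℝ (WithLp.toLp 2 u) with hL
  have hcomp : (fun g : κ → ℝ => ∑ x, g x * u x) = L ∘ WithLp.toLp 2 := by
    ext g
    simp [hL, PiLp.inner_apply]
  rw [hcomp, ← Measure.map_map L.continuous.measurable (by fun_prop), map_pi_eq_stdGaussian,
    IsGaussian.map_eq_gaussianReal, integral_strongDual_stdGaussian, variance_dual_stdGaussian,
    hL, innerSL_apply_norm, EuclideanSpace.norm_sq_eq]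
  simp [hu]

instance isProbabilityMeasure_gaussianArray (p : ℕ) (κ : Type) [Fintype κ] :
    IsProbabilityMeasure (gaussianArray p κ) := by
  unfold gaussianArray; infer_instance

lemma map_sum_sq_sum_mul_gaussianArray {m : ℕ} [NeZero m] {κ : Type} [Fintype κ] {u : κ → ℝ}
    (hu : ∑ x, u x ^ 2 = 1) :
    (gaussianArray m κ).map (fun G => ∑ o, (∑ x, G o x * u x) ^ 2) =
      gammaMeasure (m / 2) (1 / 2) := by
  have hrows : (gaussianArray m κ).map (fun G o => ∑ x, G o x * u x) =
      Measure.pi fun _ : Fin m => gaussianReal 0 1 := by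
    rw [gaussianArray, Measure.pi_map_pi (f := fun _ (g : κ → ℝ) => ∑ x, g x * u x)
      fun _ => Measurable.aemeasurable (by fun_prop)]
    simp_rw [map_sum_mul_pi_gaussianReal hu]
  rw [← Fintype.card_fin m, ← map_sum_sq_pi_gaussianReal, ← hrows,
    Measure.map_map (by fun_prop) (by fun_prop), Fintype.card_fin]
  rfl

lemma ofReal_zpow {y : ℝ} (hy : 0 < y) (q : ℤ) :
    ENNReal.ofReal (y ^ q) = ENNReal.ofReal y ^ q := by
  obtain ⟨n, rfl | rfl⟩ := q.eq_nat_or_neg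
  · simp [ENNReal.ofReal_pow hy.le]
  · rw [ENNReal.zpow_neg, zpow_neg, ENNReal.ofReal_inv_of_pos (by positivity)]
    simp [ENNReal.ofReal_pow hy.le]

lemma ofReal_mul_zpow {x : ℝ} (hx : 0 < x) (y : ℝ) (q : ℤ) :
    ENNReal.ofReal (x * y) ^ q = ENNReal.ofReal x ^ q * ENNReal.ofReal y ^ q := by
  rw [ENNReal.ofReal_mul hx.le]
  obtain ⟨n, rfl | rfl⟩ := q.eq_nat_or_neg
  · simp [mul_pow]
  · simp only [ENNReal.zpow_neg, zpow_natCast, mul_pow]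
    exact ENNReal.mul_inv (.inl (by simpa using fun h => absurd h hx.not_ge))
      (.inl (ENNReal.pow_ne_top ENNReal.ofReal_ne_top))

lemma measurable_ofReal_zpow (q : ℤ) : Measurable fun x : ℝ => ENNReal.ofReal x ^ q := by
  obtain ⟨n, rfl | rfl⟩ := q.eq_nat_or_neg <;> simp only [ENNReal.zpow_neg, zpow_natCast] <;>
    fun_prop

lemma ofReal_arith_mean_zpow_le_of_pos {τ : Type*} [Fintype τ] {w z : τ → ℝ} (hw : ∀ k, 0 ≤ w k)
    (hw1 : ∑ k, w k = 1) (hz : ∀ k, 0 < z k) (q : ℤ) :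
    ENNReal.ofReal (∑ k, w k * z k) ^ q ≤
      ∑ k, ENNReal.ofReal (w k) * ENNReal.ofReal (z k) ^ q := by
  have hmean : 0 < ∑ k, w k * z k :=
    (convex_Ioi (0 : ℝ)).sum_mem (fun k _ => hw k) hw1 fun k _ => hz k
  calc ENNReal.ofReal (∑ k, w k * z k) ^ q = ENNReal.ofReal ((∑ k, w k * z k) ^ q) :=
        (ofReal_zpow hmean q).symm
    _ ≤ ENNReal.ofReal (∑ k, w k * z k ^ q) := ENNReal.ofReal_le_ofReal
        (Real.zpow_arith_mean_le_arith_mean_zpow _ w z (fun k _ => hw k) hw1 (fun k _ => hz k) q)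
    _ = ∑ k, ENNReal.ofReal (w k) * ENNReal.ofReal (z k) ^ q := by
        rw [ENNReal.ofReal_sum_of_nonneg fun k _ => mul_nonneg (hw k) (zpow_nonneg (hz k).le q)]
        exact Finset.sum_congr rfl fun k _ => by rw [ENNReal.ofReal_mul (hw k), ofReal_zpow (hz k)]

lemma ofReal_arith_mean_zpow_le {τ : Type*} [Fintype τ] {w z : τ → ℝ} (hw : ∀ k, 0 ≤ w k)
    (hw1 : ∑ k, w k = 1) (hz : ∀ k, 0 ≤ z k) (q : ℤ) :
    ENNReal.ofReal (∑ k, w k * z k) ^ q ≤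
      ∑ k, ENNReal.ofReal (w k) * ENNReal.ofReal (z k) ^ q := by
  by_cases hpos : ∀ k, w k ≠ 0 → 0 < z k
  · have h := ofReal_arith_mean_zpow_le_of_pos hw hw1 (z := fun k => if w k = 0 then 1 else z k)
      (fun k => by by_cases hk : w k = 0 <;> simp [hk, hpos k]) q
    convert h using 2 with k
    · exact congrArg _ (Finset.sum_congr rfl fun k _ => by by_cases hk : w k = 0 <;> simp [hk])
    · by_cases hk : w k = 0 <;> simp [hk]
  obtain ⟨n, rfl | rfl⟩ := q.eq_nat_or_neg
  · simp only [zpow_natCast, ← ENNReal.ofReal_pow (hz _), ← ENNReal.ofReal_mul (hw _)]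
    rw [← ENNReal.ofReal_sum_of_nonneg fun k _ => mul_nonneg (hw k) (pow_nonneg (hz k) n),
      ← ENNReal.ofReal_pow (Finset.sum_nonneg fun k _ => mul_nonneg (hw k) (hz k))]
    exact ENNReal.ofReal_le_ofReal (Real.pow_arith_mean_le_arith_mean_pow Finset.univ w z
      (fun k _ => hw k) hw1 (fun k _ => hz k) n)
  · push Not at hpos
    obtain ⟨k, hwk, hzk⟩ := hpos
    rcases n.eq_zero_or_pos with rfl | hn
    · simp [← ENNReal.ofReal_sum_of_nonneg fun k _ => hw k, hw1]
    refine le_top.trans_eq (ENNReal.sum_eq_top.2 ⟨k, Finset.mem_univ k, ?_⟩).symm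
    rw [ENNReal.ofReal_of_nonpos hzk, ENNReal.zpow_neg, zpow_natCast, zero_pow hn.ne',
      ENNReal.inv_zero, ENNReal.mul_top (by simpa using (hw k).lt_of_ne' hwk)]

lemma lintegral_ofReal_zpow_gammaMeasure {a r : ℝ} {q : ℤ} (ha : 0 < a) (haq : 0 < a + q)
    (hr : 0 < r) :
    ∫⁻ x, ENNReal.ofReal x ^ q ∂(gammaMeasure a r) =
      ENNReal.ofReal (Real.Gamma (a + q) / (Real.Gamma a * r ^ q)) := by
  have h := lintegral_rpow_mul_exp_gammaMeasure ha haq hr hr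
  simp only [zero_mul, Real.exp_zero, mul_one, Real.rpow_intCast, sub_zero] at h
  rw [Real.rpow_add hr, Real.rpow_intCast, mul_left_comm,
    mul_div_mul_left _ _ (by positivity)] at h
  rw [← h]
  refine lintegral_congr_ae ?_
  filter_upwards [ae_gammaMeasure_pos a r] with x hx using (ofReal_zpow hx q).symm

lemma lintegral_ofReal_zpow_sum_sq_gaussianArray_le {m : ℕ} [NeZero m] {q : ℤ}
    (hq : 4 * |q| ≤ m) {κ : Type} [Fintype κ] {u : κ → ℝ} (hu : ∑ x, u x ^ 2 = 1) :
    ∫⁻ G, ENNReal.ofReal (∑ o, (∑ x, G o x * u x) ^ 2) ^ q ∂(gaussianArray m κ) ≤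
      ENNReal.ofReal (Real.exp (4 * (q : ℝ) ^ 2 / m)) * ENNReal.ofReal m ^ q := by
  have hm : (0 : ℝ) < m := by exact_mod_cast NeZero.pos m
  have hqm : |2 * (q : ℝ) / m| ≤ 1 / 2 := by
    rw [abs_div, abs_mul, abs_two, abs_of_pos hm, div_le_iff₀ hm]
    linarith [show 4 * |(q : ℝ)| ≤ m by exact_mod_cast hq]
  have hsum : (0 : ℝ) < m / 2 + q := by
    have h := (abs_le.1 hqm).1
    rw [le_div_iff₀ hm] at h
    linarith
  have := Real.Gamma_pos_of_pos (half_pos hm)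
  calc _ = ∫⁻ x, ENNReal.ofReal x ^ q ∂(gammaMeasure (m / 2) (1 / 2)) := by
        rw [← map_sum_sq_sum_mul_gaussianArray hu,
          lintegral_map (measurable_ofReal_zpow q) (by fun_prop)]
    _ = ENNReal.ofReal (Real.Gamma (m / 2 + q) / (Real.Gamma (m / 2) * (1 / 2) ^ q)) :=
        lintegral_ofReal_zpow_gammaMeasure (half_pos hm) hsum one_half_pos
    _ ≤ ENNReal.ofReal ((1 + 2 * q / m) ^ q * m ^ q) := by
        refine ENNReal.ofReal_le_ofReal ?_
        rw [div_le_iff₀ (by positivity)]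
        refine (Gamma_add_int_le (half_pos hm) hsum).trans_eq ?_
        rw [mul_left_comm, ← mul_zpow, ← mul_zpow]
        congr 2
        field_simp
    _ ≤ ENNReal.ofReal (Real.exp (4 * (q : ℝ) ^ 2 / m) * m ^ q) := by
        gcongr
        refine (one_add_zpow_le_exp hqm q ?_).trans_eq (congrArg Real.exp (by ring))
        rw [show (q : ℝ) * (2 * q / m) = 2 * q ^ 2 / m by ring]
        positivity
    _ = _ := by rw [ENNReal.ofReal_mul (Real.exp_pos _).le, ofReal_zpow hm]

/-- Left multiplication by the random matrix `S` multiplies the expectation of the functional `F`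
of the squared Frobenius norm by at most `c`, whatever matrix `S` is applied to. Allowing matrices
with any number of columns makes the property stable under Kronecker products with identities. -/
def FrobBound {Ω : Type*} [MeasurableSpace Ω] {ρ κ : Type} [Fintype ρ] [Fintype κ]
    (μ : Measure Ω) (S : Ω → Matrix ρ κ ℝ) (F : ℝ → ℝ≥0∞) (c : ℝ≥0∞) : Prop :=
  ∀ (τ : Type) [Fintype τ] (M : Matrix κ τ ℝ), ∫⁻ ω, F (frobSq (S ω * M)) ∂μ ≤ c * F (frobSq M)

/-- The normalized Gaussian embedding `(1/√m) G`. -/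
noncomputable def gaussianMatrix {m : ℕ} {κ : Type} (G : Fin m → κ → ℝ) : Matrix (Fin m) κ ℝ :=
  Matrix.of fun o x => (1 / √(m : ℝ)) * G o x

lemma frobSq_nonneg {κ τ : Type*} [Fintype κ] [Fintype τ] (M : Matrix κ τ ℝ) : 0 ≤ frobSq M :=
  Finset.sum_nonneg fun _ _ => Finset.sum_nonneg fun _ _ => sq_nonneg _

lemma frobSq_eq_zero_iff {κ τ : Type*} [Fintype κ] [Fintype τ] {M : Matrix κ τ ℝ} :
    frobSq M = 0 ↔ M = 0 := by
  rw [frobSq, ← Fintype.sum_prod_type' (fun x y => M x y ^ 2),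
    Fintype.sum_eq_zero_iff_of_nonneg fun _ => sq_nonneg _, ← Matrix.ext_iff]
  simp [funext_iff]

lemma lintegral_ofReal_zpow_sum_sq_div_gaussianArray_le {m : ℕ} [NeZero m] {q : ℤ}
    (hq : 4 * |q| ≤ m) {κ : Type} [Fintype κ] {u : κ → ℝ} (hu : 0 < ∑ x, u x ^ 2) :
    ∫⁻ G, ENNReal.ofReal ((∑ o, (∑ x, G o x * u x) ^ 2) / ∑ x, u x ^ 2) ^ q ∂(gaussianArray m κ) ≤
      ENNReal.ofReal (Real.exp (4 * (q : ℝ) ^ 2 / m)) * ENNReal.ofReal m ^ q := by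
  set v := ∑ x, u x ^ 2
  have hunit : ∑ x, (u x / √v) ^ 2 = 1 := by
    simp_rw [div_pow, Real.sq_sqrt hu.le, ← Finset.sum_div]
    exact div_self hu.ne'
  refine le_of_eq_of_le ?_ (lintegral_ofReal_zpow_sum_sq_gaussianArray_le hq hunit)
  simp_rw [← mul_div_assoc, ← Finset.sum_div, div_pow, Real.sq_sqrt hu.le, ← Finset.sum_div]

lemma frobSq_gaussianMatrix_mul {m : ℕ} {κ τ : Type} [Fintype κ] [Fintype τ]
    (G : Fin m → κ → ℝ) (M : Matrix κ τ ℝ) :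
    frobSq (gaussianMatrix G * M) = (∑ k, ∑ o, (∑ x, G o x * M x k) ^ 2) / m := by
  rw [frobSq, Finset.sum_comm]
  simp_rw [Finset.sum_div, Matrix.mul_apply, gaussianMatrix, Matrix.of_apply, mul_assoc,
    ← Finset.mul_sum, mul_pow, div_pow, one_pow, Real.sq_sqrt m.cast_nonneg, one_div_mul_eq_div]

lemma frobSq_gaussianMatrix_mul_eq_mean {m : ℕ} {κ τ : Type} [Fintype κ] [Fintype τ]
    (G : Fin m → κ → ℝ) {M : Matrix κ τ ℝ} (hM : frobSq M ≠ 0) :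
    frobSq (gaussianMatrix G * M) = frobSq M / m * ∑ k, (∑ x, M x k ^ 2) / frobSq M *
      ((∑ o, (∑ x, G o x * M x k) ^ 2) / ∑ x, M x k ^ 2) := by
  rw [frobSq_gaussianMatrix_mul, Finset.sum_div, Finset.mul_sum]
  refine Finset.sum_congr rfl fun k _ => ?_
  by_cases hk : ∑ x, M x k ^ 2 = 0
  · have hcol : ∀ x, M x k = 0 := fun x => by
      simpa using (Finset.sum_eq_zero_iff_of_nonneg fun x _ => sq_nonneg (M x k)).1 hk x
    simp [hcol]
  · field_simp

lemma sum_sum_sq_div_frobSq {κ τ : Type*} [Fintype κ] [Fintype τ] {M : Matrix κ τ ℝ}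
    (hM : frobSq M ≠ 0) : ∑ k, (∑ x, M x k ^ 2) / frobSq M = 1 := by
  rw [← Finset.sum_div, Finset.sum_comm]
  exact div_self hM

lemma ofReal_frobSq_gaussianMatrix_mul_zpow_le {m : ℕ} [NeZero m] {κ τ : Type} [Fintype κ]
    [Fintype τ] (G : Fin m → κ → ℝ) {M : Matrix κ τ ℝ} (hM : 0 < frobSq M) (q : ℤ) :
    ENNReal.ofReal (frobSq (gaussianMatrix G * M)) ^ q ≤
      ENNReal.ofReal (frobSq M / m) ^ q * ∑ k, ENNReal.ofReal ((∑ x, M x k ^ 2) / frobSq M) *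
        ENNReal.ofReal ((∑ o, (∑ x, G o x * M x k) ^ 2) / ∑ x, M x k ^ 2) ^ q := by
  have hm : (0 : ℝ) < m := by exact_mod_cast NeZero.pos m
  rw [frobSq_gaussianMatrix_mul_eq_mean G hM.ne', ofReal_mul_zpow (by positivity)]
  exact mul_le_mul_right (ofReal_arith_mean_zpow_le (fun k => by positivity)
    (sum_sum_sq_div_frobSq hM.ne') (fun k => by positivity) q) _

theorem frobBound_gaussianMatrix {m : ℕ} [NeZero m] {q : ℤ} (hq : 4 * |q| ≤ m) (κ : Type)
    [Fintype κ] :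
    FrobBound (gaussianArray m κ) gaussianMatrix (fun y => ENNReal.ofReal y ^ q)
      (ENNReal.ofReal (Real.exp (4 * (q : ℝ) ^ 2 / m))) := by
  intro τ _ M
  have hm : (0 : ℝ) < m := by exact_mod_cast NeZero.pos m
  set c := ENNReal.ofReal (Real.exp (4 * (q : ℝ) ^ 2 / m))
  rcases (frobSq_nonneg M).eq_or_lt' with hM | hM
  · have hc : 1 ≤ c := by simpa [c] using by positivity
    simpa [frobSq_eq_zero_iff.1 hM, frobSq] using
      le_mul_of_one_le_left (zero_le (a := (0 : ℝ≥0∞) ^ q)) hc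
  set w : τ → ℝ := fun k => (∑ x, M x k ^ 2) / frobSq M
  set z : τ → (Fin m → κ → ℝ) → ℝ := fun k G =>
    (∑ o, (∑ x, G o x * M x k) ^ 2) / ∑ x, M x k ^ 2
  have hcol : ∀ k, ENNReal.ofReal (w k) * ∫⁻ G, ENNReal.ofReal (z k G) ^ q ∂(gaussianArray m κ) ≤
      ENNReal.ofReal (w k) * (c * ENNReal.ofReal m ^ q) := by
    intro k
    rcases (show 0 ≤ ∑ x, M x k ^ 2 by positivity).eq_or_lt with h | h
    · simp [w, ← h]
    · exact mul_le_mul_right (lintegral_ofReal_zpow_sum_sq_div_gaussianArray_le hq h) _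
  have hmeas : ∀ k, Measurable fun G => ENNReal.ofReal (z k G) ^ q := fun k =>
    (measurable_ofReal_zpow q).comp (by fun_prop)
  calc ∫⁻ G, ENNReal.ofReal (frobSq (gaussianMatrix G * M)) ^ q ∂(gaussianArray m κ)
      ≤ ∫⁻ G, ENNReal.ofReal (frobSq M / m) ^ q *
          ∑ k, ENNReal.ofReal (w k) * ENNReal.ofReal (z k G) ^ q ∂(gaussianArray m κ) :=
        lintegral_mono fun G => ofReal_frobSq_gaussianMatrix_mul_zpow_le G hM q
    _ = ENNReal.ofReal (frobSq M / m) ^ q * ∑ k, ENNReal.ofReal (w k) *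
          ∫⁻ G, ENNReal.ofReal (z k G) ^ q ∂(gaussianArray m κ) := by
        rw [lintegral_const_mul _ (by fun_prop), lintegral_finsetSum _ (by fun_prop)]
        simp_rw [lintegral_const_mul _ (hmeas _)]
    _ ≤ ENNReal.ofReal (frobSq M / m) ^ q * ∑ k, ENNReal.ofReal (w k) *
          (c * ENNReal.ofReal m ^ q) :=
        mul_le_mul_right (Finset.sum_le_sum fun k _ => hcol k) _
    _ = c * ENNReal.ofReal (frobSq M) ^ q := by
        rw [← Finset.sum_mul, ← ENNReal.ofReal_sum_of_nonneg fun k _ => by positivity,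
          sum_sum_sq_div_frobSq hM.ne', ENNReal.ofReal_one, one_mul, mul_left_comm,
          ← ofReal_mul_zpow (by positivity), div_mul_cancel₀ _ hm.ne']

/-! ### Products and Kronecker products of random matrices -/

section FrobBound

variable {Ω Ω' : Type*} [MeasurableSpace Ω] [MeasurableSpace Ω'] {μ : Measure Ω} {ν : Measure Ω'}
  {ρ κ σ : Type} [Fintype ρ] [Fintype κ] [Fintype σ] {F : ℝ → ℝ≥0∞} {c d : ℝ≥0∞}

lemma FrobBound.comp {S : Ω → Matrix ρ κ ℝ} {T : Ω' → Matrix σ ρ ℝ}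
    (hT : FrobBound ν T F d) (hS : FrobBound μ S F c) (hd : d ≠ ⊤) :
    FrobBound (μ.prod ν) (fun ω => T ω.2 * S ω.1) F (d * c) := by
  intro τ _ M
  calc ∫⁻ ω, F (frobSq (T ω.2 * S ω.1 * M)) ∂(μ.prod ν)
      ≤ ∫⁻ ω, ∫⁻ ω', F (frobSq (T ω' * (S ω * M))) ∂ν ∂μ := by
        simp_rw [Matrix.mul_assoc]
        exact lintegral_prod_le _
    _ ≤ ∫⁻ ω, d * F (frobSq (S ω * M)) ∂μ := lintegral_mono fun ω => hT τ _
    _ ≤ d * (c * F (frobSq M)) := by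
        rw [lintegral_const_mul' _ _ hd]
        exact mul_le_mul_right (hS τ M) d
    _ = d * c * F (frobSq M) := (mul_assoc _ _ _).symm

lemma mul_kronecker_one_apply {σ ρ κ υ : Type*} [Fintype ρ] [Fintype υ] [DecidableEq υ]
    (P : Matrix σ (ρ × υ) ℝ) (S : Matrix ρ κ ℝ) (o : σ) (x : κ) (u : υ) :
    (P * (S ⊗ₖ (1 : Matrix υ υ ℝ))) o (x, u) = ∑ a, P o (a, u) * S a x := by
  simp [Matrix.mul_apply, Fintype.sum_prod_type, Matrix.one_apply]

lemma mul_one_kronecker_apply {σ ρ κ υ : Type*} [Fintype ρ] [Fintype υ] [DecidableEq υ]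
    (P : Matrix σ (υ × ρ) ℝ) (S : Matrix ρ κ ℝ) (o : σ) (u : υ) (x : κ) :
    (P * ((1 : Matrix υ υ ℝ) ⊗ₖ S)) o (u, x) = ∑ a, P o (u, a) * S a x := by
  simp [Matrix.mul_apply, Fintype.sum_prod_type_right, Matrix.one_apply]

lemma FrobBound.kronecker_one {S : Ω → Matrix ρ κ ℝ} (hS : FrobBound μ S F c) (υ : Type)
    [Fintype υ] [DecidableEq υ] :
    FrobBound μ (fun ω => S ω ⊗ₖ (1 : Matrix υ υ ℝ)) F c := by
  intro τ _ M
  have h := hS (υ × τ) (Matrix.of fun x w => M (x, w.1) w.2)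
  simp only [frobSq, Matrix.mul_apply, Fintype.sum_prod_type, Matrix.of_apply,
    Matrix.kroneckerMap_apply, Matrix.one_apply, mul_ite, mul_one, mul_zero, ite_mul, zero_mul,
    Finset.sum_ite_eq, Finset.mem_univ, if_true] at h ⊢
  exact h

lemma FrobBound.one_kronecker {S : Ω → Matrix ρ κ ℝ} (hS : FrobBound μ S F c) (υ : Type)
    [Fintype υ] [DecidableEq υ] :
    FrobBound μ (fun ω => (1 : Matrix υ υ ℝ) ⊗ₖ S ω) F c := by
  intro τ _ M
  have h := hS (υ × τ) (Matrix.of fun x w => M (w.1, x) w.2)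
  simp only [frobSq, Matrix.mul_apply, Fintype.sum_prod_type, Matrix.of_apply] at h
  simp only [frobSq, Matrix.mul_apply, Fintype.sum_prod_type_right, Matrix.kroneckerMap_apply,
    Matrix.one_apply, ite_mul, zero_mul, one_mul, Finset.sum_ite_eq, Finset.mem_univ, if_true]
  exact h

lemma frobSq_eq_trace {κ τ : Type*} [Fintype κ] [Fintype τ] (M : Matrix κ τ ℝ) :
    frobSq M = (M.transpose * M).trace := by
  simp only [frobSq, Matrix.trace, Matrix.diag_apply, Matrix.mul_apply, Matrix.transpose_apply,
    ← sq]
  exact Finset.sum_comm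

lemma frobSq_mul_of_transpose_mul_self {κ τ ρ : Type*} [Fintype κ] [Fintype τ] [Fintype ρ]
    [DecidableEq ρ] {A : Matrix κ ρ ℝ} (hA : A.transpose * A = 1) (M : Matrix ρ τ ℝ) :
    frobSq (A * M) = frobSq M := by
  rw [frobSq_eq_trace, frobSq_eq_trace, Matrix.transpose_mul, Matrix.mul_assoc,
    ← Matrix.mul_assoc _ A, hA, Matrix.one_mul]

lemma FrobBound.submatrix {S : Ω → Matrix ρ κ ℝ} (hS : FrobBound μ S F c) {φ : σ → κ}
    (hφ : Function.Injective φ) : FrobBound μ (fun ω => (S ω).submatrix id φ) F c := by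
  classical
  intro τ _ M
  set E : Matrix κ σ ℝ := (1 : Matrix κ κ ℝ).submatrix id φ
  have hE : E.transpose * E = 1 := by
    rw [Matrix.transpose_submatrix, Matrix.transpose_one,
      ← Matrix.submatrix_mul _ _ _ _ _ Function.bijective_id, Matrix.one_mul,
      Matrix.submatrix_one φ hφ]
  have hSE : ∀ ω, (S ω).submatrix id φ = S ω * E := fun ω =>
    (Matrix.mul_submatrix_one (Equiv.refl κ) φ (S ω)).symm
  simpa only [hSE, Matrix.mul_assoc, frobSq_mul_of_transpose_mul_self hE] using hS τ (E * M)

end FrobBound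

namespace SketchNetwork

variable {ι : Type} {m : ℕ}

/-- The multi-indices of the sketched edges, arranged along the tree. -/
def Index (s : ℕ) : SketchNetwork ι m → Type
  | leaf _ => Fin s
  | node l r _ _ _ => l.Index s × r.Index s

instance instFintypeIndex (s : ℕ) : (T : SketchNetwork ι m) → Fintype (T.Index s)
  | leaf _ => inferInstanceAs (Fintype (Fin s))
  | node l r _ _ _ =>
      letI := instFintypeIndex s l
      letI := instFintypeIndex s r
      inferInstanceAs (Fintype (l.Index s × r.Index s))

instance instDecidableEqIndex (s : ℕ) : (T : SketchNetwork ι m) → DecidableEq (T.Index s)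
  | leaf _ => inferInstanceAs (DecidableEq (Fin s))
  | node l r _ _ _ =>
      letI := instDecidableEqIndex s l
      letI := instDecidableEqIndex s r
      inferInstanceAs (DecidableEq (l.Index s × r.Index s))

/-- The arrangement along the tree of a multi-index of the sketched edges. It is injective when
every data vertex is at a leaf. -/
def toIndex (s : ℕ) : (T : SketchNetwork ι m) → (ι → Fin s) → T.Index s
  | leaf j, x => x j
  | node l r _ _ _, x => (l.toIndex s x, r.toIndex s x)

lemma apply_eq_of_toIndex_eq (s : ℕ) (T : SketchNetwork ι m) {x y : ι → Fin s}
    (h : T.toIndex s x = T.toIndex s y) : ∀ j ∈ T.leaves, x j = y j := by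
  induction T with
  | leaf j =>
    intro k hk
    obtain rfl := List.mem_singleton.1 hk
    exact h
  | node l r _ _ _ ihl ihr =>
    intro k hk
    obtain ⟨hl, hr⟩ := Prod.mk.inj h
    exact (List.mem_append.1 hk).elim (ihl hl k) (ihr hr k)

lemma IsContractionTree.toIndex_injective {T : SketchNetwork ι m} (hT : T.IsContractionTree)
    (s : ℕ) : Function.Injective (T.toIndex s) :=
  fun _ _ h => funext fun j => T.apply_eq_of_toIndex_eq s h j (hT.2 j)

/-- The sketch applied at a contraction to the pair of the sketch dimensions of `U` and `V`, as a
matrix: the dimension of `V` is split along `e`, then `v₁` and `v₂` are applied. -/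
noncomputable def pairSketch {α β : ℕ} (e : Fin m ↪ Fin α × Fin β)
    (G₁ : Fin m → Fin m × Fin α → ℝ) (G₂ : Fin m → Fin m × Fin β → ℝ) :
    Matrix (Fin m) (Fin m × Fin m) ℝ :=
  gaussianMatrix G₂ * (gaussianMatrix G₁ ⊗ₖ (1 : Matrix (Fin β) (Fin β) ℝ)).submatrix id
    fun a => ((a.1, (e a.2).1), (e a.2).2)

/-- The embedding, as a product of normalized Gaussian matrices tensored with identities and with
its columns indexed along the tree. -/
noncomputable def contractMatrix (s : ℕ) :
    (T : SketchNetwork ι m) → T.Sample s → Matrix (Fin m) (T.Index s) ℝ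
  | leaf _, G => gaussianMatrix (κ := Fin s) G
  | node l r _ _ e, (Gl, Gr, G₁, G₂) =>
      (pairSketch e G₁ G₂ * ((1 : Matrix (Fin m) (Fin m) ℝ) ⊗ₖ r.contractMatrix s Gr) *
        (l.contractMatrix s Gl ⊗ₖ (1 : Matrix (r.Index s) (r.Index s) ℝ)) :
          Matrix (Fin m) (l.Index s × r.Index s) ℝ)

lemma pairSketch_apply {α β : ℕ} (e : Fin m ↪ Fin α × Fin β)
    (G₁ : Fin m → Fin m × Fin α → ℝ) (G₂ : Fin m → Fin m × Fin β → ℝ) (o a b : Fin m) :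
    pairSketch e G₁ G₂ o (a, b) =
      ∑ q, (1 / √(m : ℝ)) * G₁ q (a, (e b).1) * ((1 / √(m : ℝ)) * G₂ o (q, (e b).2)) := by
  simp [pairSketch, Matrix.mul_apply, Fintype.sum_prod_type, gaussianMatrix, Matrix.one_apply,
    mul_comm, mul_left_comm, mul_assoc]

lemma contract_eq_contractMatrix (s : ℕ) (T : SketchNetwork ι m) (G : T.Sample s) (o : Fin m)
    (x : ι → Fin s) : T.contract s G o x = T.contractMatrix s G o (T.toIndex s x) := by
  induction T generalizing o with
  | leaf j => rfl
  | node l r α β e ihl ihr =>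
    obtain ⟨Gl, Gr, G₁, G₂⟩ := G
    simp only [contract, contractMatrix, toIndex, ihl, ihr, mul_kronecker_one_apply,
      mul_one_kronecker_apply, pairSketch_apply, Finset.sum_mul]
    refine Finset.sum_congr rfl fun a _ => Finset.sum_congr rfl fun b _ =>
      Finset.sum_congr rfl fun q _ => ?_
    ring

lemma embedding_eq_submatrix (s : ℕ) (T : SketchNetwork ι m) (G : T.Sample s) :
    T.embedding s G = (T.contractMatrix s G).submatrix id (T.toIndex s) :=
  Matrix.ext fun o x => T.contract_eq_contractMatrix s G o x

/-- The number of tensors of the embedding. -/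
def size : SketchNetwork ι m → ℕ
  | leaf _ => 1
  | node l r _ _ _ => l.size + r.size + 2

lemma size_pos (T : SketchNetwork ι m) : 0 < T.size := by
  cases T <;> simp [size]

lemma size_add_two (T : SketchNetwork ι m) : T.size + 2 = 3 * T.leaves.length := by
  induction T with
  | leaf j => rfl
  | node l r _ _ _ ihl ihr => simp only [size, leaves, List.length_append]; omega

lemma IsContractionTree.size_le [Fintype ι] {T : SketchNetwork ι m}
    (hT : T.IsContractionTree) : T.size ≤ 3 * Fintype.card ι := by
  have := T.size_add_two
  have := hT.1.length_le_card
  omega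

instance isProbabilityMeasure_law (s : ℕ) :
    (T : SketchNetwork ι m) → IsProbabilityMeasure (T.law s)
  | leaf _ => isProbabilityMeasure_gaussianArray m (Fin s)
  | node l r α β _ =>
      letI := isProbabilityMeasure_law s l
      letI := isProbabilityMeasure_law s r
      inferInstanceAs (IsProbabilityMeasure ((l.law s).prod ((r.law s).prod
        ((gaussianArray m (Fin m × Fin α)).prod (gaussianArray m (Fin m × Fin β))))))

lemma measurable_contract (s : ℕ) (T : SketchNetwork ι m) (o : Fin m) (x : ι → Fin s) :
    Measurable fun G : T.Sample s => T.contract s G o x := by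
  induction T generalizing o with
  | leaf j =>
    change Measurable fun G : Fin m → Fin s → ℝ => (1 / √(m : ℝ)) * G o (x j)
    fun_prop
  | node l r α β e ihl ihr =>
    change Measurable fun G : l.Sample s × r.Sample s ×
        (Fin m → Fin m × Fin α → ℝ) × (Fin m → Fin m × Fin β → ℝ) =>
      ∑ a : Fin m, ∑ b : Fin m, ∑ q : Fin m,
        l.contract s G.1 a x * r.contract s G.2.1 b x *
          ((1 / √(m : ℝ)) * G.2.2.1 q (a, (e b).1)) *
          ((1 / √(m : ℝ)) * G.2.2.2 o (q, (e b).2))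
    fun_prop

section FrobBound

variable {F : ℝ → ℝ≥0∞} {c : ℝ≥0∞}

lemma frobBound_pairSketch
    (hF : ∀ (κ : Type) [Fintype κ], FrobBound (gaussianArray m κ) gaussianMatrix F c) (hc : c ≠ ⊤)
    {α β : ℕ} (e : Fin m ↪ Fin α × Fin β) :
    FrobBound ((gaussianArray m (Fin m × Fin α)).prod (gaussianArray m (Fin m × Fin β)))
      (fun G => pairSketch e G.1 G.2) F (c * c) := by
  have hsplit : Function.Injective fun a : Fin m × Fin m => ((a.1, (e a.2).1), (e a.2).2) := by
    intro a b h
    simp only [Prod.mk.injEq] at h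
    exact Prod.ext h.1.1 (e.injective (Prod.ext h.1.2 h.2))
  have hv₁ := ((hF (Fin m × Fin α)).kronecker_one (Fin β)).submatrix hsplit
  simpa only [pairSketch] using (hF (Fin m × Fin β)).comp hv₁ hc

theorem frobBound_contractMatrix
    (hF : ∀ (κ : Type) [Fintype κ], FrobBound (gaussianArray m κ) gaussianMatrix F c) (hc : c ≠ ⊤)
    (s : ℕ) (T : SketchNetwork ι m) :
    FrobBound (T.law s) (T.contractMatrix s) F (c ^ T.size) := by
  induction T with
  | leaf j => exact (pow_one c).symm ▸ hF (Fin s)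
  | node l r α β e ihl ihr =>
    have h := (((frobBound_pairSketch hF hc e).comp (ihr.one_kronecker (Fin m))
      (ENNReal.mul_ne_top hc hc)).comp (ihl.kronecker_one (r.Index s))
      (ENNReal.mul_ne_top (ENNReal.mul_ne_top hc hc) (ENNReal.pow_ne_top hc)))
    rw [show c ^ (node l r α β e).size = c * c * c ^ r.size * c ^ l.size by
      simp only [size]; ring]
    exact h

theorem frobBound_embedding [Fintype ι] [DecidableEq ι]
    (hF : ∀ (κ : Type) [Fintype κ], FrobBound (gaussianArray m κ) gaussianMatrix F c) (hc : c ≠ ⊤)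
    (s : ℕ) {T : SketchNetwork ι m} (hT : T.IsContractionTree) :
    FrobBound (T.law s) (T.embedding s) F (c ^ T.size) := by
  simpa only [← embedding_eq_submatrix] using
    (T.frobBound_contractMatrix hF hc s).submatrix (hT.toIndex_injective s)

end FrobBound

end SketchNetwork

/-! ### Moments of the embedding of a vector -/

/-- The random linear map `S` preserves the squared norm of each fixed vector up to a relative
error whose moment of order `2 p` is at most `D`. -/
def MomentBound {Ω E F : Type*} [MeasurableSpace Ω] [NormedAddCommGroup E] [NormedSpace ℝ E]
    [NormedAddCommGroup F] [NormedSpace ℝ F] (μ : Measure Ω) (S : Ω → E →ₗ[ℝ] F) (p : ℕ)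
    (D : ℝ) : Prop :=
  ∀ x, ∫⁻ ω, ENNReal.ofReal ((‖S ω x‖ ^ 2 - ‖x‖ ^ 2) ^ (2 * p)) ∂μ ≤
    ENNReal.ofReal (D * (‖x‖ ^ 2) ^ (2 * p))

lemma momentBound_of_norm_eq_one {Ω E F : Type*} [MeasurableSpace Ω] [NormedAddCommGroup E]
    [NormedSpace ℝ E] [NormedAddCommGroup F] [NormedSpace ℝ F] {μ : Measure Ω}
    {S : Ω → E →ₗ[ℝ] F} {p : ℕ} {D : ℝ} (hp : p ≠ 0)
    (h : ∀ u, ‖u‖ = 1 →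
      ∫⁻ ω, ENNReal.ofReal ((‖S ω u‖ ^ 2 - 1) ^ (2 * p)) ∂μ ≤ ENNReal.ofReal D) :
    MomentBound μ S p D := by
  intro x
  rcases eq_or_ne x 0 with rfl | hx
  · simp [hp]
  set u := ‖x‖⁻¹ • x
  have hu : ‖u‖ = 1 := norm_smul_inv_norm hx
  have hscale : ∀ ω, (‖S ω x‖ ^ 2 - ‖x‖ ^ 2) ^ (2 * p) =
      (‖x‖ ^ 2) ^ (2 * p) * (‖S ω u‖ ^ 2 - 1) ^ (2 * p) := fun ω => by
    rw [← mul_pow, map_smul, norm_smul, norm_inv, norm_norm]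
    have := norm_ne_zero_iff.2 hx
    field_simp
  simp_rw [hscale, mul_comm D, ENNReal.ofReal_mul (show 0 ≤ (‖x‖ ^ 2) ^ (2 * p) by positivity)]
  rw [lintegral_const_mul' _ _ ENNReal.ofReal_ne_top]
  exact mul_le_mul_right (h u hu) _

lemma abs_mul_sub_one_le {y : ℝ} (hy : 0 < y) (j : ℕ) :
    |j * (y - 1)| ≤ max (y ^ j) (y⁻¹ ^ j) := by
  have hbernoulli : ∀ z : ℝ, 0 < z → j * (z - 1) ≤ z ^ j := fun z hz => by
    have := one_add_mul_sub_le_pow (show -1 ≤ z by linarith) j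
    linarith
  have hinv : 1 - y ≤ y⁻¹ - 1 := by
    rw [le_sub_iff_add_le, ← one_div, le_div_iff₀ hy]
    nlinarith [sq_nonneg (y - 1)]
  refine abs_le'.2 ⟨(hbernoulli y hy).trans (le_max_left _ _), le_max_of_le_right ?_⟩
  calc -(j * (y - 1)) = j * (1 - y) := by ring
    _ ≤ j * (y⁻¹ - 1) := by gcongr
    _ ≤ y⁻¹ ^ j := hbernoulli _ (inv_pos.2 hy)

lemma ofReal_mul_sub_one_pow_le {y : ℝ} (hy : 0 ≤ y) {p j : ℕ} (hpj : 2 * p * j ≠ 0) :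
    ENNReal.ofReal ((j * (y - 1)) ^ (2 * p)) ≤
      ENNReal.ofReal y ^ ((2 * p * j : ℕ) : ℤ) + ENNReal.ofReal y ^ (-(2 * p * j : ℕ) : ℤ) := by
  rcases hy.eq_or_lt with rfl | hy
  · refine le_top.trans_eq ?_
    rw [ENNReal.zpow_neg, zpow_natCast, ENNReal.ofReal_zero, zero_pow hpj, ENNReal.inv_zero,
      add_top]
  rw [← ofReal_zpow hy, ← ofReal_zpow hy, ← ENNReal.ofReal_add (by positivity) (by positivity)]
  refine ENNReal.ofReal_le_ofReal ?_
  calc (j * (y - 1)) ^ (2 * p) = |j * (y - 1)| ^ (2 * p) := ((even_two_mul p).pow_abs _).symm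
    _ ≤ max (y ^ j) (y⁻¹ ^ j) ^ (2 * p) := by gcongr; exact abs_mul_sub_one_le hy j
    _ ≤ (y ^ j) ^ (2 * p) + (y⁻¹ ^ j) ^ (2 * p) := by
        rcases max_choice (y ^ j) (y⁻¹ ^ j) with h | h <;> rw [h]
        · exact le_add_of_nonneg_right (by positivity)
        · exact le_add_of_nonneg_left (by positivity)
    _ = _ := by rw [zpow_neg, zpow_natCast, ← inv_pow, ← pow_mul, ← pow_mul, mul_comm j]

lemma lintegral_sub_one_pow_le {Ω : Type*} [MeasurableSpace Ω] {μ : Measure Ω} {Y : Ω → ℝ}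
    (hY : ∀ ω, 0 ≤ Y ω) (hYm : Measurable Y) {C : ℝ} {p j : ℕ} (hpj : 2 * p * j ≠ 0)
    (h : ∀ q : ℤ, |q| = 2 * p * j → ∫⁻ ω, ENNReal.ofReal (Y ω) ^ q ∂μ ≤ ENNReal.ofReal C) :
    ∫⁻ ω, ENNReal.ofReal ((Y ω - 1) ^ (2 * p)) ∂μ ≤
      ENNReal.ofReal (2 * C / (j : ℝ) ^ (2 * p)) := by
  have hj : (0 : ℝ) < (j : ℝ) ^ (2 * p) := by
    have : j ≠ 0 := by rintro rfl; simp at hpj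
    positivity
  have hmul : ENNReal.ofReal ((j : ℝ) ^ (2 * p)) * ∫⁻ ω, ENNReal.ofReal ((Y ω - 1) ^ (2 * p)) ∂μ ≤
      ENNReal.ofReal C + ENNReal.ofReal C := by
    rw [← lintegral_const_mul' _ _ ENNReal.ofReal_ne_top]
    simp_rw [← ENNReal.ofReal_mul hj.le, ← mul_pow]
    have hmeas : Measurable fun ω => ENNReal.ofReal (Y ω) ^ ((2 * p * j : ℕ) : ℤ) :=
      (measurable_ofReal_zpow _).comp hYm
    refine (lintegral_mono fun ω => ofReal_mul_sub_one_pow_le (hY ω) hpj).trans ?_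
    rw [lintegral_add_left hmeas]
    exact add_le_add (h _ (by simp)) (h _ (by simp))
  rw [ENNReal.ofReal_div_of_pos hj, ENNReal.le_div_iff_mul_le
    (.inl (ENNReal.ofReal_pos.2 hj).ne') (.inl ENNReal.ofReal_ne_top), mul_comm,
    ENNReal.ofReal_mul zero_le_two, ENNReal.ofReal_ofNat, two_mul (ENNReal.ofReal C)]
  exact hmul

namespace SketchNetwork

variable {ι : Type} [Fintype ι] [DecidableEq ι] {m : ℕ}

/-- The embedding as a linear map between Euclidean spaces. -/
noncomputable def linearEmbedding (s : ℕ) (T : SketchNetwork ι m) (G : T.Sample s) :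
    EuclideanSpace ℝ (ι → Fin s) →ₗ[ℝ] EuclideanSpace ℝ (Fin m) :=
  Matrix.toEuclideanLin (T.embedding s G)

lemma norm_sq_linearEmbedding (s : ℕ) (T : SketchNetwork ι m) (G : T.Sample s)
    (x : EuclideanSpace ℝ (ι → Fin s)) :
    ‖T.linearEmbedding s G x‖ ^ 2 = frobSq (T.embedding s G * Matrix.replicateCol Unit x) := by
  rw [EuclideanSpace.real_norm_sq_eq]
  simp [frobSq, linearEmbedding, Matrix.mul_apply, Matrix.mulVec, dotProduct]

lemma measurable_linearEmbedding (s : ℕ) (T : SketchNetwork ι m)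
    (x : EuclideanSpace ℝ (ι → Fin s)) : Measurable fun G => T.linearEmbedding s G x := by
  refine (WithLp.measurable_toLp 2 (Fin m → ℝ)).comp (measurable_pi_lambda _ fun o => ?_)
  exact Finset.measurable_sum _ fun z _ => (T.measurable_contract s o z).mul_const _

lemma lintegral_zpow_norm_sq_linearEmbedding_le (s : ℕ) {T : SketchNetwork ι m}
    (hT : T.IsContractionTree) [NeZero m] {q : ℤ} (hq : 4 * |q| ≤ m)
    (x : EuclideanSpace ℝ (ι → Fin s)) :
    ∫⁻ G, ENNReal.ofReal (‖T.linearEmbedding s G x‖ ^ 2) ^ q ∂(T.law s) ≤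
      ENNReal.ofReal (Real.exp (12 * Fintype.card ι * (q : ℝ) ^ 2 / m)) *
        ENNReal.ofReal (‖x‖ ^ 2) ^ q := by
  have hsize : (T.size : ℝ) ≤ 3 * Fintype.card ι := by exact_mod_cast hT.size_le
  have h := frobBound_embedding (frobBound_gaussianMatrix hq) ENNReal.ofReal_ne_top s hT Unit
    (Matrix.replicateCol Unit x)
  simp_rw [← norm_sq_linearEmbedding] at h
  refine h.trans (mul_le_mul' ?_ (le_of_eq ?_))
  · rw [← ENNReal.ofReal_pow (Real.exp_pos _).le, ← Real.exp_nat_mul]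
    refine ENNReal.ofReal_le_ofReal (Real.exp_le_exp.2 ?_)
    calc (T.size : ℝ) * (4 * (q : ℝ) ^ 2 / m)
        ≤ 3 * Fintype.card ι * (4 * (q : ℝ) ^ 2 / m) := by gcongr
      _ = 12 * Fintype.card ι * (q : ℝ) ^ 2 / m := by ring
  · simp [EuclideanSpace.real_norm_sq_eq, frobSq]

theorem momentBound_linearEmbedding (s : ℕ) {T : SketchNetwork ι m} (hT : T.IsContractionTree)
    {p j : ℕ} (hp : 0 < p) (hj : 0 < j) (hm : 48 * Fintype.card ι * p * j ^ 2 ≤ m) :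
    MomentBound (T.law s) (T.linearEmbedding s) p (2 * (Real.exp 1 / (j : ℝ) ^ 2) ^ p) := by
  have hcard : 1 ≤ Fintype.card ι := by
    have := hT.size_le
    have := T.size_pos
    omega
  have h8 : 8 * (p * j) ≤ m := calc
    8 * (p * j) ≤ 48 * (1 * (p * j * j)) := by nlinarith [Nat.le_mul_of_pos_right (p * j) hj]
    _ ≤ 48 * (Fintype.card ι * (p * j * j)) := by gcongr
    _ = 48 * Fintype.card ι * p * j ^ 2 := by ring
    _ ≤ m := hm
  have : NeZero m := ⟨by have := Nat.mul_pos hp hj; omega⟩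
  refine momentBound_of_norm_eq_one hp.ne' fun u hu => ?_
  have h := lintegral_sub_one_pow_le (C := Real.exp p) (p := p) (j := j) (μ := T.law s)
    (Y := fun G => ‖T.linearEmbedding s G u‖ ^ 2) (fun G => by positivity)
    ((T.measurable_linearEmbedding s u).norm.pow_const 2) (by positivity) fun q hq => ?_
  · refine h.trans_eq (congrArg _ ?_)
    rw [div_pow, ← Real.exp_nat_mul, mul_one, pow_mul, mul_div_assoc]
  · have hq8 : 4 * |q| ≤ m := by rw [hq]; zify at h8; linarith
    have hexp : 12 * Fintype.card ι * (q : ℝ) ^ 2 / m ≤ p := by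
      have hq2 : (q : ℝ) ^ 2 = (2 * p * j) ^ 2 := by
        rw [← sq_abs]; congr 1; exact_mod_cast hq
      rw [hq2, div_le_iff₀ (by exact_mod_cast NeZero.pos m)]
      calc 12 * Fintype.card ι * (2 * p * j : ℝ) ^ 2
          = p * ((48 * Fintype.card ι * p * j ^ 2 : ℕ) : ℝ) := by push_cast; ring
        _ ≤ p * m := by gcongr
    refine (T.lintegral_zpow_norm_sq_linearEmbedding_le s hT hq8 u).trans ?_
    rw [hu, one_pow, ← ofReal_zpow one_pos, one_zpow, ENNReal.ofReal_one, mul_one]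
    exact ENNReal.ofReal_le_ofReal (Real.exp_le_exp.2 hexp)

end SketchNetwork

/-! ### Subspace embeddings and approximate products -/

lemma packingNumber_closedBall_le (E : Type*) [NormedAddCommGroup E] [NormedSpace ℝ E]
    [FiniteDimensional ℝ E] :
    Metric.packingNumber 1 (Metric.closedBall (0 : E) 2) ≤ (5 ^ Module.finrank ℝ E : ℕ) := by
  refine iSup_le fun C => iSup_le fun hCball => iSup_le fun hCsep => ?_
  by_contra! hlt
  obtain ⟨t, htC, htcard⟩ := Set.exists_subset_encard_eq (Order.add_one_le_of_lt hlt)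
  have htfin : t.Finite := Set.finite_of_encard_eq_coe (k := 5 ^ Module.finrank ℝ E + 1)
    (by exact_mod_cast htcard)
  have hcard : htfin.toFinset.card = 5 ^ Module.finrank ℝ E + 1 := by
    rw [htfin.encard_eq_coe_toFinset_card] at htcard
    exact_mod_cast htcard
  have hle := Besicovitch.card_le_of_separated htfin.toFinset
    (fun c hc => by simpa using hCball (htC (htfin.mem_toFinset.1 hc)))
    (fun c hc d hd hcd => by
      have hdist : 1 < edist c d :=
        hCsep (htC (htfin.mem_toFinset.1 hc)) (htC (htfin.mem_toFinset.1 hd)) hcd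
      rw [edist_dist, dist_eq_norm, ENNReal.one_lt_ofReal] at hdist
      exact hdist.le)
  omega

lemma exists_finset_isCover_closedBall (E : Type*) [NormedAddCommGroup E] [NormedSpace ℝ E]
    [FiniteDimensional ℝ E] :
    ∃ s : Finset E, s.card ≤ 5 ^ Module.finrank ℝ E ∧ (s : Set E) ⊆ Metric.closedBall 0 2 ∧
      Metric.IsCover 1 (Metric.closedBall (0 : E) 2) s := by
  have hle := packingNumber_closedBall_le E
  have htop : Metric.packingNumber 1 (Metric.closedBall (0 : E) 2) ≠ ⊤ :=
    ne_top_of_le_ne_top (ENat.natCast_ne_top _) hle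
  rw [← Metric.encard_maximalSeparatedSet htop] at hle
  have hfin : (Metric.maximalSeparatedSet 1 (Metric.closedBall (0 : E) 2)).Finite :=
    Set.finite_of_encard_le_coe hle
  refine ⟨hfin.toFinset, ?_, ?_, ?_⟩
  · rw [hfin.encard_eq_coe_toFinset_card] at hle
    exact_mod_cast hle
  · simpa only [hfin.coe_toFinset] using Metric.maximalSeparatedSet_subset
  · simpa only [hfin.coe_toFinset] using Metric.isCover_maximalSeparatedSet htop

lemma opNorm_le_of_isCover {E G : Type*} [NormedAddCommGroup E] [NormedSpace ℝ E]
    [NormedAddCommGroup G] [NormedSpace ℝ G] {s : Set E}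
    (hs : Metric.IsCover 1 (Metric.closedBall (0 : E) 2) s) (f : E →L[ℝ] G) {K : ℝ} (hK : 0 ≤ K)
    (hf : ∀ c ∈ s, ‖f c‖ ≤ K) : ‖f‖ ≤ K := by
  suffices h : ‖f‖ ≤ (K + ‖f‖) / 2 by linarith
  refine f.opNorm_le_of_unit_norm (by positivity) fun v hv => ?_
  have hv2 : (2 : ℝ) • v ∈ Metric.closedBall 0 2 := by simp [norm_smul, hv]
  obtain ⟨c, hc, hvc⟩ := Set.mem_iUnion₂.1 (hs.subset_iUnion_closedBall hv2)
  have htwo : 2 * ‖f v‖ ≤ K + ‖f‖ := calc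
    2 * ‖f v‖ = ‖f c + f ((2 : ℝ) • v - c)‖ := by
      rw [← map_add, add_sub_cancel, map_smul, norm_smul, Real.norm_ofNat]
    _ ≤ ‖f c‖ + ‖f ((2 : ℝ) • v - c)‖ := norm_add_le _ _
    _ ≤ K + ‖f‖ * 1 := add_le_add (hf c hc) (f.le_opNorm_of_le (mem_closedBall_iff_norm.1 hvc))
    _ = K + ‖f‖ := by rw [mul_one]
  linarith

section MomentMethod

variable {Ω : Type*} [MeasurableSpace Ω] {μ : Measure Ω}

lemma lintegral_sum_pow_le {κ : Type*} [Fintype κ] {f : κ → Ω → ℝ≥0∞}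
    (hf : ∀ i, Measurable (f i)) {p : ℕ} (hp : p ≠ 0) {C : ℝ≥0∞} {w : κ → ℝ≥0∞}
    (h : ∀ i, ∫⁻ ω, f i ω ^ p ∂μ ≤ C * w i ^ p) :
    ∫⁻ ω, (∑ i, f i ω) ^ p ∂μ ≤ C * (∑ i, w i) ^ p := by
  have hp1 : (1 : ℝ≥0∞) ≤ p := by exact_mod_cast Nat.one_le_iff_ne_zero.2 hp
  have hpR : (p : ℝ) ≠ 0 := by exact_mod_cast hp
  have hnorm : ∀ g : Ω → ℝ≥0∞, eLpNorm g p μ = (∫⁻ ω, g ω ^ p ∂μ) ^ (1 / (p : ℝ)) := fun g => by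
    rw [eLpNorm_eq_lintegral_rpow_enorm_toReal (by simpa using hp) (ENNReal.natCast_ne_top p)]
    simp
  have hroot : (∫⁻ ω, (∑ i, f i ω) ^ p ∂μ) ^ (1 / (p : ℝ)) ≤ C ^ (1 / (p : ℝ)) * ∑ i, w i := calc
    (∫⁻ ω, (∑ i, f i ω) ^ p ∂μ) ^ (1 / (p : ℝ)) = eLpNorm (∑ i, f i) p μ := by
      simp only [hnorm, Finset.sum_apply]
    _ ≤ ∑ i, eLpNorm (f i) p μ := eLpNorm_sum_le (fun i _ => (hf i).aestronglyMeasurable) hp1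
    _ ≤ ∑ i, C ^ (1 / (p : ℝ)) * w i := by
      refine Finset.sum_le_sum fun i _ => ?_
      rw [hnorm]
      refine (ENNReal.rpow_le_rpow (h i) (by positivity)).trans_eq ?_
      rw [ENNReal.mul_rpow_of_nonneg _ _ (by positivity), ← ENNReal.rpow_natCast,
        ← ENNReal.rpow_mul, mul_one_div_cancel hpR, ENNReal.rpow_one]
    _ = C ^ (1 / (p : ℝ)) * ∑ i, w i := (Finset.mul_sum _ _ _).symm
  have hpow := pow_le_pow_left' hroot p
  rwa [mul_pow, ← ENNReal.rpow_mul_natCast, ← ENNReal.rpow_mul_natCast, one_div_mul_cancel hpR,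
    ENNReal.rpow_one, ENNReal.rpow_one] at hpow

lemma measure_mul_lt_le_of_lintegral_pow_le {Z : Ω → ℝ} (hZ : Measurable Z) {p : ℕ} (hp : p ≠ 0)
    {a w D : ℝ} (ha : 0 < a) (hw : 0 ≤ w)
    (h : ∫⁻ ω, ENNReal.ofReal (Z ω ^ p) ∂μ ≤ ENNReal.ofReal (D * w ^ p)) :
    μ {ω | a * w < Z ω} ≤ ENNReal.ofReal (D / a ^ p) := by
  rcases hw.eq_or_lt with rfl | hw
  · have hae : ∀ᵐ ω ∂μ, ENNReal.ofReal (Z ω ^ p) = 0 := by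
      refine (lintegral_eq_zero_iff (by fun_prop)).1 (le_antisymm ?_ zero_le)
      simpa [hp] using h
    refine (measure_mono_null (fun ω hω => ?_) hae).trans_le zero_le
    have hpos : 0 < Z ω := by simpa using hω
    simpa using pow_pos hpos p
  have hsub : {ω | a * w < Z ω} ⊆
      {ω | ENNReal.ofReal ((a * w) ^ p) ≤ ENNReal.ofReal (Z ω ^ p)} := fun ω hω =>
    ENNReal.ofReal_le_ofReal (pow_le_pow_left₀ (by positivity) (le_of_lt hω) p)
  calc μ {ω | a * w < Z ω}
      ≤ (∫⁻ ω, ENNReal.ofReal (Z ω ^ p) ∂μ) / ENNReal.ofReal ((a * w) ^ p) :=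
        (measure_mono hsub).trans (meas_ge_le_lintegral_div (by fun_prop)
          (ENNReal.ofReal_pos.2 (by positivity)).ne' ENNReal.ofReal_ne_top)
    _ ≤ ENNReal.ofReal (D * w ^ p) / ENNReal.ofReal ((a * w) ^ p) := by gcongr
    _ = ENNReal.ofReal (D / a ^ p) := by
        rw [← ENNReal.ofReal_div_of_pos (by positivity), mul_pow,
          mul_div_mul_right _ _ (by positivity)]

end MomentMethod

section InnerProductSpace

variable {E F : Type*} [NormedAddCommGroup E] [InnerProductSpace ℝ E]
  [NormedAddCommGroup F] [InnerProductSpace ℝ F]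

lemma abs_norm_sq_sub_le_of_isCover [FiniteDimensional ℝ E] {s : Set E}
    (hs2 : s ⊆ Metric.closedBall 0 2) (hs : Metric.IsCover 1 (Metric.closedBall (0 : E) 2) s)
    (A : E →ₗ[ℝ] F) {θ : ℝ} (hθ : 0 ≤ θ)
    (hadd : ∀ c ∈ s, ∀ d ∈ s, |‖A (c + d)‖ ^ 2 - ‖c + d‖ ^ 2| ≤ θ * ‖c + d‖ ^ 2)
    (hsub : ∀ c ∈ s, ∀ d ∈ s, |‖A (c - d)‖ ^ 2 - ‖c - d‖ ^ 2| ≤ θ * ‖c - d‖ ^ 2) (v : E) :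
    |‖A v‖ ^ 2 - ‖v‖ ^ 2| ≤ 4 * θ * ‖v‖ ^ 2 := by
  set A' : E →L[ℝ] F := LinearMap.toContinuousLinearMap A
  set B : E →L[ℝ] E →L[ℝ] ℝ :=
    (innerSL ℝ : F →L[ℝ] F →L[ℝ] ℝ).bilinearComp A' A' - (innerSL ℝ : E →L[ℝ] E →L[ℝ] ℝ)
  have hBapp : ∀ x y, B x y = ⟪A x, A y⟫_ℝ - ⟪x, y⟫_ℝ := fun x y => rfl
  have hsq : ∀ c ∈ s, ‖c‖ ^ 2 ≤ 4 := fun c hc => by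
    have : ‖c‖ ≤ 2 := by simpa using hs2 hc
    nlinarith [norm_nonneg c]
  have hBs : ∀ c ∈ s, ∀ d ∈ s, ‖B c d‖ ≤ 4 * θ := by
    intro c hc d hd
    have hplus := hadd c hc d hd
    have hminus := hsub c hc d hd
    rw [map_add, norm_add_sq_real, norm_add_sq_real, abs_le] at hplus
    rw [map_sub, norm_sub_sq_real, norm_sub_sq_real, abs_le] at hminus
    have hcd : θ * (‖c‖ ^ 2 + ‖d‖ ^ 2) ≤ θ * 8 := by
      gcongr
      linarith [hsq c hc, hsq d hd]
    rw [hBapp, Real.norm_eq_abs, abs_le]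
    constructor <;> linarith [hplus.1, hplus.2, hminus.1, hminus.2]
  have hB : ‖B‖ ≤ 4 * θ := opNorm_le_of_isCover hs B (by positivity) fun c hc =>
    opNorm_le_of_isCover hs (B c) (by positivity) (hBs c hc)
  calc |‖A v‖ ^ 2 - ‖v‖ ^ 2| = ‖B v v‖ := by
        rw [hBapp, real_inner_self_eq_norm_sq, real_inner_self_eq_norm_sq, Real.norm_eq_abs]
    _ ≤ ‖B‖ * ‖v‖ * ‖v‖ := B.le_opNorm₂ v v
    _ ≤ 4 * θ * ‖v‖ * ‖v‖ := by gcongr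
    _ = 4 * θ * ‖v‖ ^ 2 := by ring

variable {Ω : Type*} [MeasurableSpace Ω] {μ : Measure Ω} [MeasurableSpace F] [BorelSpace F]
  {S : Ω → E →ₗ[ℝ] F} {p : ℕ} {D : ℝ}

namespace MomentBound

lemma measure_norm_sq_deviation_le (h : MomentBound μ S p D) (hS : ∀ x, Measurable fun ω => S ω x)
    (hp : p ≠ 0) {θ : ℝ} (hθ : 0 < θ) (x : E) :
    μ {ω | θ * ‖x‖ ^ 2 < |‖S ω x‖ ^ 2 - ‖x‖ ^ 2|} ≤ ENNReal.ofReal (D / θ ^ (2 * p)) :=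
  measure_mul_lt_le_of_lintegral_pow_le (((hS x).norm.pow_const 2).sub_const _).abs
    (mul_ne_zero two_ne_zero hp) hθ (by positivity)
    (by simpa only [(even_two_mul p).pow_abs] using h x)

theorem measure_subspace_distortion_le [FiniteDimensional ℝ E] (h : MomentBound μ S p D)
    (hS : ∀ x, Measurable fun ω => S ω x) (hp : p ≠ 0) {θ : ℝ} (hθ : 0 < θ) :
    μ {ω | ∃ v, 4 * θ * ‖v‖ ^ 2 < |‖S ω v‖ ^ 2 - ‖v‖ ^ 2|} ≤
      2 * 25 ^ Module.finrank ℝ E * ENNReal.ofReal (D / θ ^ (2 * p)) := by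
  obtain ⟨s, hcard, hs2, hs⟩ := exists_finset_isCover_closedBall E
  set bad : E → Set Ω := fun x => {ω | θ * ‖x‖ ^ 2 < |‖S ω x‖ ^ 2 - ‖x‖ ^ 2|} with hbad
  have hbad_le : ∀ x, μ (bad x) ≤ ENNReal.ofReal (D / θ ^ (2 * p)) :=
    h.measure_norm_sq_deviation_le hS hp hθ
  have hsub : {ω | ∃ v, 4 * θ * ‖v‖ ^ 2 < |‖S ω v‖ ^ 2 - ‖v‖ ^ 2|} ⊆
      ⋃ q ∈ s ×ˢ s, (bad (q.1 + q.2) ∪ bad (q.1 - q.2)) := by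
    rintro ω ⟨v, hv⟩
    by_contra hgood
    simp only [Set.mem_iUnion, not_exists, Set.mem_union, not_or, hbad, Set.mem_ofPred_eq,
      not_lt, Finset.mem_product, and_imp, Prod.forall] at hgood
    exact hv.not_ge (abs_norm_sq_sub_le_of_isCover hs2 hs (S ω) hθ.le
      (fun c hc d hd => (hgood c d hc hd).1) (fun c hc d hd => (hgood c d hc hd).2) v)
  calc μ {ω | ∃ v, 4 * θ * ‖v‖ ^ 2 < |‖S ω v‖ ^ 2 - ‖v‖ ^ 2|}
      ≤ ∑ q ∈ s ×ˢ s, μ (bad (q.1 + q.2) ∪ bad (q.1 - q.2)) :=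
        (measure_mono hsub).trans (measure_biUnion_finset_le _ _)
    _ ≤ ∑ q ∈ s ×ˢ s, 2 * ENNReal.ofReal (D / θ ^ (2 * p)) := by
        refine Finset.sum_le_sum fun q _ => (measure_union_le _ _).trans ?_
        rw [two_mul]
        exact add_le_add (hbad_le _) (hbad_le _)
    _ = (s.card * s.card : ℕ) * (2 * ENNReal.ofReal (D / θ ^ (2 * p))) := by
        rw [Finset.sum_const, Finset.card_product, nsmul_eq_mul]
    _ ≤ (5 ^ Module.finrank ℝ E * 5 ^ Module.finrank ℝ E : ℕ) *
          (2 * ENNReal.ofReal (D / θ ^ (2 * p))) := by gcongr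
    _ = 2 * 25 ^ Module.finrank ℝ E * ENNReal.ofReal (D / θ ^ (2 * p)) := by
        rw [← mul_pow]
        push_cast
        ring

lemma lintegral_inner_pow_le_of_norm_eq_one (h : MomentBound μ S p D)
    (hS : ∀ x, Measurable fun ω => S ω x) (hp : p ≠ 0) {x y : E} (hx : ‖x‖ = 1) (hy : ‖y‖ = 1)
    (hxy : ⟪x, y⟫_ℝ = 0) :
    ∫⁻ ω, ENNReal.ofReal (⟪S ω x, S ω y⟫_ℝ ^ (2 * p)) ∂μ ≤ ENNReal.ofReal D := by
  have hadd : ‖x + y‖ ^ 2 = 2 := by rw [norm_add_sq_real, hx, hy, hxy]; norm_num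
  have hsub : ‖x - y‖ ^ 2 = 2 := by rw [norm_sub_sq_real, hx, hy, hxy]; norm_num
  set dev : E → Ω → ℝ := fun z ω => ‖S ω z‖ ^ 2 - ‖z‖ ^ 2 with hdev
  have hdev_meas : ∀ z, Measurable (dev z) := fun z => ((hS z).norm.pow_const 2).sub_const _
  have hpolar : ∀ ω, 4 * ⟪S ω x, S ω y⟫_ℝ = dev (x + y) ω - dev (x - y) ω := fun ω => by
    simp only [hdev, hadd, hsub, map_add, map_sub, norm_add_sq_real, norm_sub_sq_real]
    ring
  have hdev_pow : ∀ z, ‖z‖ ^ 2 = 2 →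
      ∫⁻ ω, ENNReal.ofReal |dev z ω| ^ (2 * p) ∂μ ≤ ENNReal.ofReal D * 2 ^ (2 * p) := by
    intro z hz
    simp_rw [← ENNReal.ofReal_pow (abs_nonneg _), (even_two_mul p).pow_abs]
    refine (h z).trans_eq ?_
    rw [hz, ENNReal.ofReal_mul' (by positivity), ENNReal.ofReal_pow zero_le_two,
      ENNReal.ofReal_ofNat]
  have hminkowski := lintegral_sum_pow_le (μ := μ) (p := 2 * p) (C := ENNReal.ofReal D)
    (f := fun i : Bool => fun ω => ENNReal.ofReal |dev (bif i then x + y else x - y) ω|)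
    (w := fun _ => 2) (fun i => (hdev_meas _).abs.ennreal_ofReal) (mul_ne_zero two_ne_zero hp)
    (by rintro (_ | _); exacts [hdev_pow _ hsub, hdev_pow _ hadd])
  have hfour : 4 ^ (2 * p) * ∫⁻ ω, ENNReal.ofReal (⟪S ω x, S ω y⟫_ℝ ^ (2 * p)) ∂μ ≤
      4 ^ (2 * p) * ENNReal.ofReal D := by
    rw [← lintegral_const_mul' _ _ (by simp), mul_comm _ (ENNReal.ofReal D)]
    refine (lintegral_mono fun ω => ?_).trans (hminkowski.trans_eq (by norm_num))
    have h4 : (4 : ℝ≥0∞) = ENNReal.ofReal 4 := by simp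
    rw [Fintype.sum_bool, ← ENNReal.ofReal_add (abs_nonneg _) (abs_nonneg _),
      ← ENNReal.ofReal_pow (by positivity), h4, ← ENNReal.ofReal_pow (by positivity),
      ← ENNReal.ofReal_mul (by positivity), ← mul_pow, hpolar, ← (even_two_mul p).pow_abs]
    exact ENNReal.ofReal_le_ofReal (pow_le_pow_left₀ (abs_nonneg _) (abs_sub _ _) _)
  exact (ENNReal.mul_le_mul_iff_right (by simp) (by simp)).1 hfour

lemma lintegral_inner_pow_le (h : MomentBound μ S p D) (hS : ∀ x, Measurable fun ω => S ω x)
    (hp : p ≠ 0) {x y : E} (hxy : ⟪x, y⟫_ℝ = 0) :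
    ∫⁻ ω, ENNReal.ofReal (⟪S ω x, S ω y⟫_ℝ ^ (2 * p)) ∂μ ≤
      ENNReal.ofReal D * ENNReal.ofReal (‖x‖ ^ 2 * ‖y‖ ^ 2) ^ p := by
  rcases eq_or_ne x 0 with rfl | hx
  · simp [hp]
  rcases eq_or_ne y 0 with rfl | hy
  · simp [hp]
  have hunit := h.lintegral_inner_pow_le_of_norm_eq_one hS hp
    (norm_smul_inv_norm (𝕜 := ℝ) hx) (norm_smul_inv_norm (𝕜 := ℝ) hy)
    (by rw [inner_smul_left, inner_smul_right, hxy, mul_zero, mul_zero])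
  have hscale : ∀ ω, ⟪S ω x, S ω y⟫_ℝ ^ (2 * p) = (‖x‖ ^ 2 * ‖y‖ ^ 2) ^ p *
      ⟪S ω ((‖x‖⁻¹ : ℝ) • x), S ω ((‖y‖⁻¹ : ℝ) • y)⟫_ℝ ^ (2 * p) := fun ω => by
    rw [map_smul, map_smul, real_inner_smul_left, real_inner_smul_right, pow_mul, pow_mul,
      ← mul_pow]
    have := norm_ne_zero_iff.2 hx
    have := norm_ne_zero_iff.2 hy
    field_simp
  simp_rw [hscale, ENNReal.ofReal_mul (show 0 ≤ (‖x‖ ^ 2 * ‖y‖ ^ 2) ^ p by positivity)]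
  rw [lintegral_const_mul' _ _ ENNReal.ofReal_ne_top, mul_comm,
    ENNReal.ofReal_pow (by positivity)]
  exact mul_le_mul_left hunit _

theorem measure_sum_inner_sq_le [SecondCountableTopology F] (h : MomentBound μ S p D)
    (hS : ∀ x, Measurable fun ω => S ω x) (hp : p ≠ 0) {ρ τ : Type*} [Fintype ρ] [Fintype τ]
    {u : ρ → E} {b : τ → E} (hu : ∀ r, ‖u r‖ = 1) (hub : ∀ r t, ⟪u r, b t⟫_ℝ = 0) {a : ℝ}
    (ha : 0 < a) :
    μ {ω | a * ∑ t, ‖b t‖ ^ 2 < ∑ r, ∑ t, ⟪S ω (u r), S ω (b t)⟫_ℝ ^ 2} ≤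
      ENNReal.ofReal (D * (Fintype.card ρ / a) ^ p) := by
  have hmeas : ∀ x y, Measurable fun ω => ⟪S ω x, S ω y⟫_ℝ ^ 2 := fun x y =>
    ((hS x).inner (hS y)).pow_const 2
  have hminkowski := lintegral_sum_pow_le (μ := μ)
    (f := fun (q : ρ × τ) ω => ENNReal.ofReal (⟪S ω (u q.1), S ω (b q.2)⟫_ℝ ^ 2))
    (w := fun q => ENNReal.ofReal (‖b q.2‖ ^ 2)) (C := ENNReal.ofReal D)
    (fun q => (hmeas _ _).ennreal_ofReal) hp fun q => by
      simpa only [← ENNReal.ofReal_pow (sq_nonneg _), ← pow_mul, hu, one_pow, one_mul] using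
        h.lintegral_inner_pow_le hS hp (hub q.1 q.2)
  have hmoment : ∫⁻ ω, ENNReal.ofReal ((∑ r, ∑ t, ⟪S ω (u r), S ω (b t)⟫_ℝ ^ 2) ^ p) ∂μ ≤
      ENNReal.ofReal (D * Fintype.card ρ ^ p * (∑ t, ‖b t‖ ^ 2) ^ p) := by
    rw [mul_assoc, ← mul_pow, ENNReal.ofReal_mul' (by positivity),
      ENNReal.ofReal_pow (by positivity)]
    convert hminkowski using 3 with ω
    · rw [← Fintype.sum_prod_type', ENNReal.ofReal_pow (by positivity),
        ENNReal.ofReal_sum_of_nonneg fun _ _ => sq_nonneg _]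
    · rw [← ENNReal.ofReal_sum_of_nonneg fun _ _ => sq_nonneg _, Fintype.sum_prod_type]
      simp
  refine (measure_mul_lt_le_of_lintegral_pow_le (Finset.measurable_sum _ fun r _ =>
    Finset.measurable_sum _ fun t _ => hmeas _ _) hp ha (by positivity) hmoment).trans_eq ?_
  rw [div_pow, mul_div_assoc]

end MomentBound

end InnerProductSpace

/-! ### Sketched least squares -/

section LeastSquares

variable {W E F : Type*} [AddCommGroup W] [Module ℝ W] [FiniteDimensional ℝ W]
  [NormedAddCommGroup E] [InnerProductSpace ℝ E] [NormedAddCommGroup F] [InnerProductSpace ℝ F]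
  {τ ρ : Type*} [Fintype τ] [Fintype ρ]

/-- The residual `y - P y` of the least squares problem `min_w ‖A w - y‖`, with `P` the orthogonal
projection onto the range of `A`. -/
noncomputable def residual (A : W →ₗ[ℝ] E) (y : E) : E :=
  y - (LinearMap.range A).starProjection y

lemma inner_residual_eq_zero (A : W →ₗ[ℝ] E) (y : E) {v : E} (hv : v ∈ LinearMap.range A) :
    ⟪v, residual A y⟫_ℝ = 0 :=
  (LinearMap.range A).inner_right_of_mem_orthogonal hv
    ((LinearMap.range A).sub_starProjection_mem_orthogonal y)

lemma norm_sq_map_sub_eq (A : W →ₗ[ℝ] E) (y : E) (w : W) :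
    ‖A w - y‖ ^ 2 =
      ‖A w - (LinearMap.range A).starProjection y‖ ^ 2 + ‖residual A y‖ ^ 2 := by
  have hmem : A w - (LinearMap.range A).starProjection y ∈ LinearMap.range A :=
    sub_mem (LinearMap.mem_range_self A w) (Submodule.starProjection_apply_mem _ y)
  have hsplit : A w - y = A w - (LinearMap.range A).starProjection y - residual A y := by
    rw [residual]
    abel
  rw [hsplit, norm_sub_sq_real, inner_residual_eq_zero A y hmem, mul_zero, sub_zero]

lemma exists_forall_sum_norm_sq_le (A : W →ₗ[ℝ] E) (y : τ → E) :
    ∃ B : τ → W, ∀ B' : τ → W, ∑ t, ‖A (B t) - y t‖ ^ 2 ≤ ∑ t, ‖A (B' t) - y t‖ ^ 2 := by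
  choose B hB using fun t => Submodule.starProjection_apply_mem (LinearMap.range A) (y t)
  refine ⟨B, fun B' => Finset.sum_le_sum fun t _ => ?_⟩
  rw [norm_sq_map_sub_eq, norm_sq_map_sub_eq A (y t) (B' t), hB, sub_self, norm_zero]
  gcongr
  positivity

lemma inner_map_le_of_orthonormalBasis {V : Submodule ℝ E} (u : OrthonormalBasis ρ ℝ V)
    (S : E →ₗ[ℝ] F) (z : V) (f : F) :
    ⟪S z, f⟫_ℝ ≤ 1 / 8 * ‖z‖ ^ 2 + 2 * ∑ r, ⟪S (u r), f⟫_ℝ ^ 2 := by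
  have hexpand : S z = ∑ r, ⟪u r, z⟫_ℝ • S (u r) := by
    conv_lhs => rw [← u.sum_repr' z]
    simp only [AddSubmonoidClass.coe_finsetSum, Submodule.coe_smul, map_sum, map_smul]
  rw [hexpand, sum_inner, ← u.sum_sq_inner_right z, Finset.mul_sum, Finset.mul_sum,
    ← Finset.sum_add_distrib]
  refine Finset.sum_le_sum fun r _ => ?_
  rw [real_inner_smul_left]
  nlinarith [sq_nonneg (⟪u r, z⟫_ℝ - 4 * ⟪S (u r), f⟫_ℝ)]

-- Since `‖S z‖² - 2 ⟪S z, f⟫ = ‖S z - f‖² - ‖f‖²`, a minimizer `z` of `‖S z - f‖` is controlled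
-- by the inner products of `f` with the sketched basis.
lemma norm_sq_le_of_half_norm_sq_le {V : Submodule ℝ E} (u : OrthonormalBasis ρ ℝ V)
    {S : E →ₗ[ℝ] F} (hS : ∀ v : V, 1 / 2 * ‖v‖ ^ 2 ≤ ‖S v‖ ^ 2) (z : V) (f : F) :
    ‖z‖ ^ 2 ≤ 16 * ∑ r, ⟪S (u r), f⟫_ℝ ^ 2 + 4 * (‖S z - f‖ ^ 2 - ‖f‖ ^ 2) := by
  have hinner := inner_map_le_of_orthonormalBasis u S z f
  have hexpand := norm_sub_sq_real (S z) f
  linarith [hS z]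

theorem sum_norm_sq_le_of_sketch {A : W →ₗ[ℝ] E} {y : τ → E} {S : E →ₗ[ℝ] F} {ε : ℝ} (hε : 0 ≤ ε)
    (u : OrthonormalBasis ρ ℝ (LinearMap.range A))
    (hS : ∀ v : LinearMap.range A, 1 / 2 * ‖v‖ ^ 2 ≤ ‖S v‖ ^ 2)
    (hprod : ∑ r, ∑ t, ⟪S (u r), S (residual A (y t))⟫_ℝ ^ 2 ≤
      ε / 16 * ∑ t, ‖residual A (y t)‖ ^ 2)
    {B : τ → W} (hB : ∀ B' : τ → W,
      ∑ t, ‖S (A (B t)) - S (y t)‖ ^ 2 ≤ ∑ t, ‖S (A (B' t)) - S (y t)‖ ^ 2) (B' : τ → W) :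
    ∑ t, ‖A (B t) - y t‖ ^ 2 ≤ (1 + ε) * ∑ t, ‖A (B' t) - y t‖ ^ 2 := by
  choose B₀ hB₀ using fun t => Submodule.starProjection_apply_mem (LinearMap.range A) (y t)
  set b : τ → E := fun t => residual A (y t) with hb
  set z : τ → LinearMap.range A := fun t => ⟨A (B t - B₀ t), LinearMap.mem_range_self A _⟩
  have hsplit : ∀ C : τ → W,
      ∑ t, ‖A (C t) - y t‖ ^ 2 = ∑ t, ‖A (C t - B₀ t)‖ ^ 2 + ∑ t, ‖b t‖ ^ 2 := fun C => by
    simp only [norm_sq_map_sub_eq, ← hB₀, ← map_sub, Finset.sum_add_distrib, hb]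
  have hsketch : ∀ w t, S (A w) - S (y t) = S (A (w - B₀ t)) - S (b t) := fun w t => by
    rw [← map_sub, ← map_sub, map_sub A, hB₀]
    simp only [hb, residual]
    congr 1
    abel
  have hopt : ∑ t, ‖S (z t) - S (b t)‖ ^ 2 ≤ ∑ t, ‖S (b t)‖ ^ 2 := by
    simpa only [hsketch, sub_self, map_zero, zero_sub, norm_neg] using hB B₀
  have hzb : ∑ t, ‖z t‖ ^ 2 ≤ ε * ∑ t, ‖b t‖ ^ 2 := by
    have hsum := Finset.sum_le_sum fun t (_ : t ∈ Finset.univ) =>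
      norm_sq_le_of_half_norm_sq_le u hS (z t) (S (b t))
    simp only [Finset.sum_add_distrib, ← Finset.mul_sum, Finset.sum_sub_distrib] at hsum
    rw [Finset.sum_comm] at hsum
    linarith
  calc ∑ t, ‖A (B t) - y t‖ ^ 2 = ∑ t, ‖z t‖ ^ 2 + ∑ t, ‖b t‖ ^ 2 := hsplit B
    _ ≤ (1 + ε) * ∑ t, ‖b t‖ ^ 2 := by linarith
    _ ≤ (1 + ε) * ∑ t, ‖A (B' t) - y t‖ ^ 2 := by
        rw [hsplit B']
        gcongr
        exact le_add_of_nonneg_left (by positivity)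

end LeastSquares

section Matrix

variable {κ : Type*} [Fintype κ] {R t : ℕ}

/-- The columns of a matrix as vectors of a Euclidean space. -/
def euclideanCol (Y : Matrix κ (Fin t) ℝ) (c : Fin t) : EuclideanSpace ℝ κ :=
  WithLp.toLp 2 (Y.col c)

lemma lsqObj_eq_sum_norm_sq (L : Matrix κ (Fin R) ℝ) (Y : Matrix κ (Fin t) ℝ)
    (B : Matrix (Fin t) (Fin R) ℝ) :
    lsqObj L Y B =
      ∑ c, ‖Matrix.toEuclideanLin L (WithLp.toLp 2 (B c)) - euclideanCol Y c‖ ^ 2 := by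
  simp_rw [EuclideanSpace.real_norm_sq_eq, lsqObj, frobSq]
  rw [Finset.sum_comm]
  rfl

lemma lsqObj_mul_eq_sum_norm_sq [DecidableEq κ] {m : ℕ} (S : Matrix (Fin m) κ ℝ)
    (L : Matrix κ (Fin R) ℝ) (Y : Matrix κ (Fin t) ℝ) (B : Matrix (Fin t) (Fin R) ℝ) :
    lsqObj (S * L) (S * Y) B =
      ∑ c, ‖Matrix.toEuclideanLin S (Matrix.toEuclideanLin L (WithLp.toLp 2 (B c))) -
        Matrix.toEuclideanLin S (euclideanCol Y c)‖ ^ 2 := by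
  rw [lsqObj_eq_sum_norm_sq]
  refine Finset.sum_congr rfl fun c _ => ?_
  congr 3
  exact congrArg (WithLp.toLp 2) (Matrix.mulVec_mulVec (B c) S L).symm

lemma exists_isLsqSolution (L : Matrix κ (Fin R) ℝ) (Y : Matrix κ (Fin t) ℝ) :
    ∃ B, IsLsqSolution L Y B := by
  obtain ⟨B, hB⟩ := exists_forall_sum_norm_sq_le (Matrix.toEuclideanLin L) (euclideanCol Y)
  refine ⟨Matrix.of fun c => (B c).ofLp, fun B' => ?_⟩
  rw [lsqObj_eq_sum_norm_sq, lsqObj_eq_sum_norm_sq]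
  exact hB fun c => WithLp.toLp 2 (B' c)

lemma isLsqAccurate_of_sketch [DecidableEq κ] {m : ℕ} {L : Matrix κ (Fin R) ℝ}
    {Y : Matrix κ (Fin t) ℝ} {S : Matrix (Fin m) κ ℝ} {ε : ℝ} (hε : 0 ≤ ε)
    {ρ : Type*} [Fintype ρ]
    (u : OrthonormalBasis ρ ℝ (LinearMap.range (Matrix.toEuclideanLin L)))
    (hS : ∀ v : LinearMap.range (Matrix.toEuclideanLin L),
      1 / 2 * ‖v‖ ^ 2 ≤ ‖Matrix.toEuclideanLin S v‖ ^ 2)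
    (hprod : ∑ r, ∑ c, ⟪Matrix.toEuclideanLin S (u r), Matrix.toEuclideanLin S
        (residual (Matrix.toEuclideanLin L) (euclideanCol Y c))⟫_ℝ ^ 2 ≤
      ε / 16 * ∑ c, ‖residual (Matrix.toEuclideanLin L) (euclideanCol Y c)‖ ^ 2)
    {B : Matrix (Fin t) (Fin R) ℝ} (hB : IsLsqSolution (S * L) (S * Y) B) :
    IsLsqAccurate ε L Y B := by
  intro B'
  rw [lsqObj_eq_sum_norm_sq, lsqObj_eq_sum_norm_sq]
  refine sum_norm_sq_le_of_sketch hε u hS hprod (B := fun c => WithLp.toLp 2 (B c)) (fun C => ?_)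
    fun c => WithLp.toLp 2 (B' c)
  have hopt := hB (Matrix.of fun c => (C c).ofLp)
  rw [lsqObj_mul_eq_sum_norm_sq, lsqObj_mul_eq_sum_norm_sq] at hopt
  exact hopt

lemma isLsqAccurate_of_isEmpty {ε : ℝ} (hε : 0 ≤ ε) (L : Matrix κ (Fin 0) ℝ)
    (Y : Matrix κ (Fin t) ℝ) (B : Matrix (Fin t) (Fin 0) ℝ) : IsLsqAccurate ε L Y B := by
  intro B'
  rw [Subsingleton.elim B' B]
  exact le_mul_of_one_le_left (frobSq_nonneg _) (by linarith)

/-- The event that the sketched least squares problem has no solution or has one that is not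
`(1 + ε)`-accurate for the original problem. -/
def sketchFailure {Ω : Type*} {m : ℕ} (S : Ω → Matrix (Fin m) κ ℝ) (ε : ℝ)
    (L : Matrix κ (Fin R) ℝ) (Y : Matrix κ (Fin t) ℝ) : Set Ω :=
  {ω | ¬ ((∃ B, IsLsqSolution (S ω * L) (S ω * Y) B) ∧
    ∀ B, IsLsqSolution (S ω * L) (S ω * Y) B → IsLsqAccurate ε L Y B)}

lemma sketchFailure_subset [DecidableEq κ] {Ω : Type*} {m : ℕ} (S : Ω → Matrix (Fin m) κ ℝ) {ε : ℝ}
    (hε : 0 ≤ ε) (L : Matrix κ (Fin R) ℝ) (Y : Matrix κ (Fin t) ℝ) {ρ : Type*} [Fintype ρ]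
    (u : OrthonormalBasis ρ ℝ (LinearMap.range (Matrix.toEuclideanLin L))) :
    sketchFailure S ε L Y ⊆
      {ω | ∃ v : LinearMap.range (Matrix.toEuclideanLin L), 4 * (1 / 8) * ‖v‖ ^ 2 <
        |‖Matrix.toEuclideanLin (S ω) v‖ ^ 2 - ‖v‖ ^ 2|} ∪
      {ω | ε / 16 * ∑ c, ‖residual (Matrix.toEuclideanLin L) (euclideanCol Y c)‖ ^ 2 <
        ∑ r, ∑ c, ⟪Matrix.toEuclideanLin (S ω) (u r), Matrix.toEuclideanLin (S ω)
          (residual (Matrix.toEuclideanLin L) (euclideanCol Y c))⟫_ℝ ^ 2} := by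
  intro ω hω
  by_contra hgood
  simp only [Set.mem_union, Set.mem_ofPred_eq, not_or, not_exists, not_lt] at hgood
  refine hω ⟨exists_isLsqSolution _ _, fun B hB =>
    isLsqAccurate_of_sketch hε u (fun v => ?_) hgood.2 hB⟩
  linarith [(abs_le.1 (hgood.1 v)).1]

theorem measure_sketchFailure_le [DecidableEq κ] {Ω : Type*} [MeasurableSpace Ω] {μ : Measure Ω}
    {m : ℕ} {S : Ω → Matrix (Fin m) κ ℝ}
    (hmeas : ∀ x, Measurable fun ω => Matrix.toEuclideanLin (S ω) x) {p q : ℕ} (hp : p ≠ 0)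
    (hq : q ≠ 0) {D D' : ℝ} (hD' : 0 ≤ D')
    (hSp : MomentBound μ (fun ω => Matrix.toEuclideanLin (S ω)) p D)
    (hSq : MomentBound μ (fun ω => Matrix.toEuclideanLin (S ω)) q D')
    (L : Matrix κ (Fin R) ℝ) (Y : Matrix κ (Fin t) ℝ) {ε : ℝ} (hε : 0 < ε) :
    μ (sketchFailure S ε L Y) ≤
      2 * 25 ^ R * ENNReal.ofReal (64 ^ p * D) + ENNReal.ofReal (D' * (16 * R / ε) ^ q) := by
  set V := LinearMap.range (Matrix.toEuclideanLin L)
  have hrank : Module.finrank ℝ V ≤ R := by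
    simpa using LinearMap.finrank_range_le (Matrix.toEuclideanLin L)
  let u := stdOrthonormalBasis ℝ V
  have hsubspace := MomentBound.measure_subspace_distortion_le
    (S := fun ω => Matrix.toEuclideanLin (S ω) ∘ₗ V.subtype) (fun v => hSp v)
    (fun v => hmeas v) hp (show (0 : ℝ) < 1 / 8 by norm_num)
  have hproduct := hSq.measure_sum_inner_sq_le hmeas hq (u := fun r => (u r : EuclideanSpace ℝ κ))
    (b := fun c => residual (Matrix.toEuclideanLin L) (euclideanCol Y c))
    (fun r => u.norm_eq_one r) (fun r c => inner_residual_eq_zero _ _ (u r).2)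
    (show 0 < ε / 16 by positivity)
  refine (measure_mono (sketchFailure_subset S hε.le L Y u)).trans
    ((measure_union_le _ _).trans (add_le_add ?_ ?_))
  · have hconst : D / (1 / 8) ^ (2 * p) = 64 ^ p * D := by
      rw [pow_mul, div_eq_inv_mul, ← inv_pow]
      norm_num
    rw [hconst] at hsubspace
    refine hsubspace.trans ?_
    gcongr
    norm_num
  · refine hproduct.trans (ENNReal.ofReal_le_ofReal ?_)
    rw [Fintype.card_fin, div_div_eq_mul_div, mul_comm (16 : ℝ)]
    gcongr

end Matrix

lemma sixteen_mul_exp_one_div_le : 16 * Real.exp 1 / 121 ≤ Real.exp (-1) := by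
  have hexp := Real.exp_one_lt_d9
  have hpos := Real.exp_pos 1
  rw [Real.exp_neg, ← one_div, div_le_div_iff₀ (by norm_num) hpos]
  nlinarith

lemma twentyFive_pow_mul_le {R p : ℕ} {l : ℝ} (hp : 3 + 4 * R + l ≤ p) :
    4 * 25 ^ R * (16 * Real.exp 1 / 121) ^ p ≤ Real.exp (-l) / 2 := by
  have he : 5 / 2 ≤ Real.exp 1 := by linarith [Real.exp_one_gt_d9]
  have h3 : 8 ≤ Real.exp 3 := calc
    (8 : ℝ) ≤ (5 / 2) ^ 3 := by norm_num
    _ ≤ Real.exp 1 ^ 3 := by gcongr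
    _ = Real.exp 3 := by rw [← Real.exp_nat_mul]; norm_num
  have h4 : 25 ≤ Real.exp 4 := calc
    (25 : ℝ) ≤ (5 / 2) ^ 4 := by norm_num
    _ ≤ Real.exp 1 ^ 4 := by gcongr
    _ = Real.exp 4 := by rw [← Real.exp_nat_mul]; norm_num
  calc 4 * 25 ^ R * (16 * Real.exp 1 / 121) ^ p
      ≤ Real.exp 3 / 2 * Real.exp 4 ^ R * Real.exp (-1) ^ p := by
        gcongr
        · linarith
        · exact sixteen_mul_exp_one_div_le
    _ = Real.exp (3 + R * 4 + p * -1) / 2 := by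
        rw [Real.exp_add, Real.exp_add, Real.exp_nat_mul, Real.exp_nat_mul]
        ring
    _ ≤ Real.exp (-l) / 2 := by
        gcongr
        linarith

section Embedding

variable {ι : Type} [Fintype ι] [DecidableEq ι] {m R s t : ℕ} {T : SketchNetwork ι m}

lemma measure_sketchFailure_embedding_le (hT : T.IsContractionTree)
    (L : Matrix (ι → Fin s) (Fin R) ℝ) (Y : Matrix (ι → Fin s) (Fin t) ℝ) {ε l : ℝ} (hε : 0 < ε)
    {p q k : ℕ} (hp : 3 + 4 * R + l ≤ p) (hq : 3 + l ≤ q) (hk : 121 * R / ε ≤ (k : ℝ) ^ 2)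
    (hp0 : 0 < p) (hq0 : 0 < q) (hk0 : 0 < k)
    (hpm : 48 * Fintype.card ι * p * 22 ^ 2 ≤ m) (hqm : 48 * Fintype.card ι * q * k ^ 2 ≤ m) :
    T.law s (sketchFailure (T.embedding s) ε L Y) ≤ ENNReal.ofReal (Real.exp (-l)) := by
  refine (measure_sketchFailure_le (T.measurable_linearEmbedding s) hp0.ne' hq0.ne'
    (by positivity) (T.momentBound_linearEmbedding s hT hp0 (by norm_num) hpm)
    (T.momentBound_linearEmbedding s hT hq0 hk0 hqm) L Y hε).trans ?_
  have hsubspace : 2 * 25 ^ R * (64 ^ p * (2 * (Real.exp 1 / (22 : ℕ) ^ 2) ^ p)) ≤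
      Real.exp (-l) / 2 := calc
    _ = 4 * 25 ^ R * (64 * (Real.exp 1 / (22 : ℕ) ^ 2)) ^ p := by rw [mul_pow]; ring
    _ = 4 * 25 ^ R * (16 * Real.exp 1 / 121) ^ p := by push_cast; ring
    _ ≤ Real.exp (-l) / 2 := twentyFive_pow_mul_le hp
  have hratio : Real.exp 1 / (k : ℝ) ^ 2 * (16 * R / ε) ≤ 16 * Real.exp 1 / 121 := by
    rw [div_mul_eq_mul_div, div_le_div_iff₀ (by positivity) (by norm_num)]
    calc Real.exp 1 * (16 * R / ε) * 121 = 16 * Real.exp 1 * (121 * R / ε) := by ring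
      _ ≤ 16 * Real.exp 1 * (k : ℝ) ^ 2 := by gcongr
  have hproduct : 2 * (Real.exp 1 / (k : ℝ) ^ 2) ^ q * (16 * R / ε) ^ q ≤ Real.exp (-l) / 2 := calc
    _ = 2 * (Real.exp 1 / (k : ℝ) ^ 2 * (16 * R / ε)) ^ q := by rw [mul_pow]; ring
    _ ≤ 4 * 25 ^ 0 * (16 * Real.exp 1 / 121) ^ q := by gcongr; norm_num
    _ ≤ Real.exp (-l) / 2 := twentyFive_pow_mul_le (by simpa using hq)
  have htwo : (2 * 25 ^ R : ℝ≥0∞) = ENNReal.ofReal (2 * 25 ^ R) := by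
    rw [ENNReal.ofReal_mul zero_le_two, ENNReal.ofReal_pow (by norm_num)]
    norm_num
  rw [htwo, ← ENNReal.ofReal_mul (by positivity), ← ENNReal.ofReal_add (by positivity)
    (by positivity)]
  exact ENNReal.ofReal_le_ofReal (by linarith)

lemma exists_nat_le_le_add_one {x : ℝ} (hx : 0 < x) : ∃ n : ℕ, 0 < n ∧ x ≤ n ∧ (n : ℝ) ≤ x + 1 :=
  ⟨⌈x⌉₊, Nat.ceil_pos.2 hx, Nat.le_ceil x, (Nat.ceil_lt_add_one hx.le).le⟩

lemma exists_nat_sq_mem_Icc {x : ℝ} (hx : 1 ≤ x) :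
    ∃ n : ℕ, 0 < n ∧ (n : ℝ) ^ 2 ∈ Set.Icc (121 * x) (144 * x) := by
  have hsqrt : 1 ≤ √x := Real.one_le_sqrt.2 hx
  have hsq : √x ^ 2 = x := Real.sq_sqrt (by linarith)
  obtain ⟨n, hn0, hle, hle'⟩ := exists_nat_le_le_add_one (show 0 < 11 * √x by positivity)
  refine ⟨n, hn0, ?_, ?_⟩ <;> nlinarith

-- The moments of order `2 p`, with `j = 22`, give the subspace embedding, and those of order `2 q`,
-- with `j = k ≈ 11 √(R / ε)`, the approximate products; `23232 = 48 * 22 ^ 2`.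
theorem measure_sketchFailure_embedding_le_exp (hT : T.IsContractionTree)
    (L : Matrix (ι → Fin s) (Fin R) ℝ) (Y : Matrix (ι → Fin s) (Fin t) ℝ) {ε l l₀ : ℝ}
    (hR : R ≠ 0) (hε : 0 < ε) (hε1 : ε ≤ 1) (hl₀ : 0 < l₀) (hl : l₀ ≤ l)
    (hm : 23232 * (8 / l₀ + 1) * (Fintype.card ι * R * l / ε) ≤ m) :
    T.law s (sketchFailure (T.embedding s) ε L Y) ≤ ENNReal.ofReal (Real.exp (-l)) := by
  have hR1 : (1 : ℝ) ≤ R := by exact_mod_cast Nat.one_le_iff_ne_zero.2 hR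
  have hlpos : 0 < l := hl₀.trans_le hl
  have hll : 8 ≤ 8 / l₀ * l := by
    rw [div_mul_eq_mul_div, le_div_iff₀ hl₀]
    linarith
  obtain ⟨p, hp0, hp, hp'⟩ := exists_nat_le_le_add_one (show 0 < 3 + 4 * (R : ℝ) + l by positivity)
  obtain ⟨q, hq0, hq, hq'⟩ := exists_nat_le_le_add_one (show 0 < 3 + l by positivity)
  obtain ⟨k, hk0, hk, hk'⟩ := exists_nat_sq_mem_Icc (x := R / ε) (by rw [one_le_div hε]; linarith)
  have hple : (p : ℝ) ≤ (8 / l₀ + 1) * (R * l) := by nlinarith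
  have hqle : (q : ℝ) ≤ (8 / l₀ + 1) * l := by linarith
  refine measure_sketchFailure_embedding_le hT L Y hε hp hq (by rwa [mul_div_assoc])
    hp0 hq0 hk0 ?_ ?_
  · rw [← Nat.cast_le (α := ℝ)]
    push_cast
    refine le_trans ?_ hm
    calc (48 : ℝ) * Fintype.card ι * p * 484
        ≤ 48 * Fintype.card ι * ((8 / l₀ + 1) * (R * l)) * 484 := by gcongr
      _ = 23232 * (8 / l₀ + 1) * (Fintype.card ι * R * l / 1) := by ring
      _ ≤ 23232 * (8 / l₀ + 1) * (Fintype.card ι * R * l / ε) := by gcongr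
  · rw [← Nat.cast_le (α := ℝ)]
    push_cast
    refine le_trans ?_ hm
    calc (48 : ℝ) * Fintype.card ι * q * k ^ 2
        ≤ 48 * Fintype.card ι * ((8 / l₀ + 1) * l) * (144 * (R / ε)) := by gcongr
      _ = 6912 * (8 / l₀ + 1) * (Fintype.card ι * R * l / ε) := by ring
      _ ≤ 23232 * (8 / l₀ + 1) * (Fintype.card ι * R * l / ε) := by gcongr; norm_num

end Embedding

end CPALS

theorem theoremG1_general (δ₀ : ℝ) (hδ₀ : δ₀ < 1) :
    ∃ C : ℝ, 0 < C ∧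
      ∀ {ι : Type} [Fintype ι] [DecidableEq ι] (R s t m : ℕ) (ε δ : ℝ), 0 < ε → ε ≤ 1 →
        0 < δ → δ ≤ δ₀ → C * (Fintype.card ι * R * Real.log (1 / δ) / ε) ≤ m →
        ∀ (L : Matrix (ι → Fin s) (Fin R) ℝ) (Y : Matrix (ι → Fin s) (Fin t) ℝ)
          (T : CPALS.SketchNetwork ι m), T.IsContractionTree →
          T.law s (CPALS.sketchFailure (T.embedding s) ε L Y) ≤ ENNReal.ofReal δ := by
  have hl₀ : 0 < 1 - δ₀ := sub_pos.2 hδ₀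
  refine ⟨23232 * (8 / (1 - δ₀) + 1), by positivity, ?_⟩
  intro ι _ _ R s t m ε δ hε hε1 hδ hδδ₀ hm L Y T hT
  have hlog : Real.log (1 / δ) = -Real.log δ := by rw [one_div, Real.log_inv]
  have hl : 1 - δ₀ ≤ Real.log (1 / δ) := by linarith [Real.log_le_sub_one_of_pos hδ]
  have hexp : Real.exp (-Real.log (1 / δ)) = δ := by rw [hlog, neg_neg, Real.exp_log hδ]
  obtain rfl | hR := eq_or_ne R 0
  · have hempty : CPALS.sketchFailure (T.embedding s) ε L Y = ∅ :=
      Set.eq_empty_of_forall_notMem fun G hG => hG ⟨CPALS.exists_isLsqSolution _ _,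
        fun B _ => CPALS.isLsqAccurate_of_isEmpty hε.le _ _ B⟩
    simp only [hempty, measure_empty, zero_le]
  · rw [← hexp]
    exact CPALS.measure_sketchFailure_embedding_le_exp hT L Y hR hε hε1 hl₀ hl hm

theorem theoremG1 (δ₀ : ℝ) (hδ₀ : δ₀ < 1) :
    ∃ C : ℝ, 0 < C ∧
      ∀ (N R s m : ℕ) (ε δ : ℝ), 0 < ε → ε ≤ 1 → 0 < δ → δ ≤ δ₀ →
        C * (N * R * Real.log (1 / δ) / ε ^ 2) ≤ m →
        ∀ (i : Fin N) (X : (Fin N → Fin s) → ℝ) (A : Fin N → Matrix (Fin s) (Fin R) ℝ)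
          (T : CPALS.SketchNetwork {j : Fin N // j ≠ i} m), T.IsContractionTree →
          T.law s {G | ¬ (
              (∃ B, CPALS.IsLsqSolution (T.embedding s G * CPALS.khatriRao A i)
                (T.embedding s G * CPALS.matricizationT X i) B) ∧
              ∀ B, CPALS.IsLsqSolution (T.embedding s G * CPALS.khatriRao A i)
                  (T.embedding s G * CPALS.matricizationT X i) B →
                CPALS.IsLsqAccurate ε (CPALS.khatriRao A i) (CPALS.matricizationT X i) B)}
            ≤ ENNReal.ofReal δ := by
  obtain ⟨C, hC, hfailure⟩ := theoremG1_general δ₀ hδ₀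
  refine ⟨C, hC, fun N R s m ε δ hε hε1 hδ hδδ₀ hm i X A T hT =>
    hfailure R s s m ε δ hε hε1 hδ hδδ₀ (le_trans ?_ hm) _ _ T hT⟩
  have hlog : 0 ≤ Real.log (1 / δ) := Real.log_nonneg (one_le_one_div hδ (hδδ₀.trans hδ₀.le))
  have hcard : Fintype.card {j : Fin N // j ≠ i} ≤ N := by
    simpa only [Fintype.card_fin] using Fintype.card_subtype_le fun j : Fin N => j ≠ i
  gcongr
  exact pow_le_of_le_one hε.le hε1 two_ne_zero
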